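/- There exist a strictly increasing sequence $\lambda_1 < \lambda_2 < \cdots$ of real numbers and functions $g$ and $g_n^*$ ($n \ge 1$) in the complex space $L^2(\mathbb{R})$ with the following properties. 1. The sequence is uniformly discrete, that is, $\inf_{n \neq m} |\lambda_m - \lambda_n| > 0$. 2. The sequence is a small perturbation of a subsequence of the positive integers: there are positive integers $k_1 < k_2 < \cdots$ such that $\lambda_n = k_n + \alpha_n$ with $\alpha_n \neq 0$ for every $n$ and $\alpha_n \to 0$ as $n \to \infty$. 3. Every $f \in L^2(\mathbb{R})$ admits the series expansion $$f(x) = \sum_{n=1}^{\infty} \langle f, g_n^* \rangle \, g(x - \lambda_n),$$ where the partial sums (in the given order) converge in the $L^2(\mathbb{R})$ norm and $\langle u, v \rangle = \int_{\mathbb{R}} u(x)\overline{v(x)}\,dx$. In other words, with the translates $(T_\lambda g)(x) = g(x-\lambda)$, the system $\{(T_{\lambda_n} g, \langle \cdot, g_n^* \rangle)\}_{n=1}^\infty$ is a Schauder frame of $L^2(\mathbb{R})$. (A system $\{(x_n, x_n^*)\}$ in $X \times X^*$, where $X$ is a Banach space with dual $X^*$, is a Schauder frame if $x = \sum_{n=1}^\infty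 x_n^*(x)\, x_n$ in norm for every $x \in X$.) -/

import Mathlib

open MeasureTheory Filter Topology

/-- The Hilbert space `L²(ℝ)` of complex-valued square-integrable functions. -/
abbrev L2R : Type := Lp ℂ 2 (volume : Measure ℝ)

/-- The translate `(T_a g)(x) = g (x - a)` of `g ∈ L²(ℝ)`. -/
noncomputable def translateL2 (a : ℝ) (g : L2R) : L2R :=
  Lp.compMeasurePreserving (fun x : ℝ => x - a) (measurePreserving_sub_right volume a) g

/-- A real sequence is uniformly discrete if `inf_{n ≠ m} |lam m - lam n| > 0`. -/
def UniformlyDiscrete (lam : ℕ → ℝ) : Prop :=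
  ∃ δ : ℝ, 0 < δ ∧ ∀ n m : ℕ, n ≠ m → δ ≤ |lam m - lam n|

/-- `lam` is a small perturbation of a subsequence of the positive integers:
`lam j = k j + α j` with positive integers `k 0 < k 1 < ⋯` and `0 ≠ α j → 0`. -/
def IsSmallPerturbationOfPositiveIntegers (lam : ℕ → ℝ) : Prop :=
  ∃ k : ℕ → ℕ, StrictMono k ∧ (∀ j, 0 < k j) ∧ (∀ j, lam j - (k j : ℝ) ≠ 0) ∧
    Tendsto (fun j => lam j - (k j : ℝ)) atTop (𝓝 0)

/-- A system `(x n, φ n)` in `X × X*` is a Schauder frame if every `v ∈ X` is the norm limit of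
the partial sums, in the given order, of `∑ φ n v • x n`. -/
def IsSchauderFrame (𝕜 : Type*) {X : Type*} [RCLike 𝕜] [NormedAddCommGroup X] [NormedSpace 𝕜 X]
    (x : ℕ → X) (φ : ℕ → X →L[𝕜] 𝕜) : Prop :=
  ∀ v : X, Tendsto (fun N => ∑ n ∈ Finset.range N, φ n v • x n) atTop (𝓝 v)

open scoped ENNReal FourierTransform ContDiff InnerProductSpace
open AddCircle (haarAddCircle)

/-! The Fourier transform turns translation by `λ` into multiplication by `exp (2πiλt)`, so the task
is to find one weight `G` in `L²` and offsets `a n > 0` tending to `0` such that the functions `exp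
(2πi(n + 1 + a n)t) G(t)` have suitable coefficient functionals. Unperturbed integer frequencies
would only give periodic multiples of `G`.

Let `u k` be a Parseval sequence. It suffices to cut the frequencies into consecutive blocks, the
`k`-th having a linear combination `P k` within `2⁻ᵏ/4` of `u k` and uniformly bounded partial sums
(`exists_dual_of_blocks`). Then `f ↦ ∑ ⟨u k, f⟩ P k` is a small perturbation of the identity, hence
invertible, and the unfinished block in a partial sum vanishes in the limit because its coefficient
`⟨u k, V f⟩` tends to `0`.

The blocks come from two facts. First, for a positive weight with Gaussian decay the exponentials of
frequency `a` in `(0, η)` span a dense subspace of `L²(G²)`, by analyticity of the transform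
(`exists_mem_span_expo_near`). Second, on the circle the constant `1` is approximated, off a set `B`
of small measure, by polynomials with arbitrarily high positive integer frequencies whose partial
sums stay below an absolute constant in `L²(Bᶜ)` (`exists_circle_block`). Multiplying by `expo a`
shifts these frequencies by `a` and approximates `expo a` (`exists_block_expo`); the bad set is
neutralised by making the weight tiny, but positive, over `B`.

Linear combinations follow, and averaging many successive approximations of the same function lowers
the bound on partial sums to about the norm of the target (`Approximable.improve`). Each target `u
k` costs a small decrease of the weight; the decreases are summable and chosen small relative to the
blocks already built, so the limiting weight serves all blocks at once. -/

/-- `x` is a sum of terms `y k ∈ T k`, `N ≤ k < N'`, all of whose partial sums lie in `S`. -/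
def BlockSum {X : Type*} [AddCommMonoid X] (T : ℕ → Set X) (N N' : ℕ) (S : Set X) (x : X) : Prop :=
  N ≤ N' ∧ ∃ y : ℕ → X, (∀ k, y k ∈ T k) ∧
    (∀ m, N ≤ m → m ≤ N' → ∑ k ∈ Finset.Ico N m, y k ∈ S) ∧ ∑ k ∈ Finset.Ico N N', y k = x

/-! ### Operations on block sums -/

namespace BlockSum

variable {X Y : Type*} [AddCommMonoid X] [AddCommMonoid Y] {T : ℕ → Set X} {N N' N'' : ℕ}
  {S S' R : Set X} {x y : X}

theorem mono (h : BlockSum T N N' S x) (hS : S ⊆ R) : BlockSum T N N' R x := by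
  obtain ⟨h0, z, h1, h2, h3⟩ := h
  exact ⟨h0, z, h1, fun m a b => hS (h2 m a b), h3⟩

theorem mem (h : BlockSum T N N' S x) : x ∈ S := by
  obtain ⟨h0, z, h1, h2, h3⟩ := h
  exact h3 ▸ h2 N' h0 le_rfl

theorem zero (hT : ∀ k, (0 : X) ∈ T k) (hN : N ≤ N') : BlockSum T N N' {0} 0 :=
  ⟨hN, fun _ => 0, hT, fun _ _ _ => by simp, by simp⟩

theorem concat (h : BlockSum T N N' S x) (h' : BlockSum T N' N'' S' y) (hS : S ⊆ R)
    (hS' : ∀ z ∈ S', x + z ∈ R) : BlockSum T N N'' R (x + y) := by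
  obtain ⟨h0, z, h1, h2, h3⟩ := h
  obtain ⟨g0, w, g1, g2, g3⟩ := h'
  have e1 : ∀ m ≤ N', ∑ k ∈ Finset.Ico N m, (if k < N' then z k else w k)
      = ∑ k ∈ Finset.Ico N m, z k := fun m hm => Finset.sum_congr rfl fun k hk => by
    rw [if_pos (lt_of_lt_of_le (Finset.mem_Ico.1 hk).2 hm)]
  have e2 : ∀ m, N' ≤ m → ∑ k ∈ Finset.Ico N m, (if k < N' then z k else w k)
      = x + ∑ k ∈ Finset.Ico N' m, w k := fun m hm => by
    rw [← Finset.sum_Ico_consecutive _ h0 hm, e1 _ le_rfl, h3]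
    congr 1
    exact Finset.sum_congr rfl fun k hk => by rw [if_neg (not_lt.2 (Finset.mem_Ico.1 hk).1)]
  refine ⟨h0.trans g0, fun k => if k < N' then z k else w k, fun k => ?_, fun m a b => ?_, ?_⟩
  · dsimp only; split_ifs
    exacts [h1 k, g1 k]
  · rcases le_total m N' with hm | hm
    · rw [e1 m hm]; exact hS (h2 m a hm)
    · rw [e2 m hm]; exact hS' _ (g2 m hm b)
  · rw [e2 _ g0, g3]

theorem pad (hT : ∀ k, (0 : X) ∈ T k) (h : BlockSum T N N' S x) (hN : N' ≤ N'') :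
    BlockSum T N N'' S x := by
  have := h.concat (zero hT hN) subset_rfl (fun z hz => by rw [hz, add_zero]; exact h.mem)
  rwa [add_zero] at this

theorem map (f : X →+ Y) {T' : ℕ → Set Y} {S' : Set Y} (h : BlockSum T N N' S x)
    (hT : ∀ k, ∀ z ∈ T k, f z ∈ T' k) (hS : ∀ z ∈ S, f z ∈ S') : BlockSum T' N N' S' (f x) := by
  obtain ⟨h0, z, h1, h2, h3⟩ := h
  refine ⟨h0, fun k => f (z k), fun k => hT k _ (h1 k), fun m a b => ?_, ?_⟩
  · rw [← map_sum]; exact hS _ (h2 m a b)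
  · rw [← map_sum, h3]

end BlockSum

/-! ### Fourier windows on the circle -/

/-- Multiples of the exponential of frequency `k + 1` on the circle. -/
def circleAtom (k : ℕ) : Set (UnitAddCircle → ℂ) :=
  {f | ∃ c : ℂ, f = fun t => c * fourier ((k : ℤ) + 1) t}

theorem zero_mem_circleAtom (k : ℕ) : (0 : UnitAddCircle → ℂ) ∈ circleAtom k :=
  ⟨0, by ext; simp⟩

theorem nnnorm_fourier_apply (n : ℤ) (t : UnitAddCircle) : ‖fourier n t‖₊ = 1 := by
  rw [fourier_apply]; exact NNReal.eq (Circle.norm_coe _)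

/-- Bessel's inequality bounds every finite subsum, not only the symmetric ones; arbitrary subsums
arise when a shifted window is cut in the middle. -/
theorem exists_fourier_partial_sum {f : UnitAddCircle → ℂ} (hf : MemLp f 2 haarAddCircle)
    {κ : ℝ≥0∞} (hκ : κ ≠ 0) : ∃ (a : ℤ → ℂ) (L : ℕ),
      (∀ s : Finset ℤ, eLpNorm (fun t => ∑ r ∈ s, a r * fourier r t) 2 (haarAddCircle (T := 1))
        ≤ eLpNorm f 2 haarAddCircle) ∧
      eLpNorm (fun t => (∑ r ∈ Finset.Icc (-(L : ℤ)) L, a r * fourier r t) - f t) 2 haarAddCircle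
        ≤ κ := by
  have key : ∀ s : Finset ℤ, (∑ r ∈ s, fourierCoeff f r • fourierLp (T := 1) 2 r : 
      Lp ℂ 2 (haarAddCircle (T := 1))) =ᵐ[haarAddCircle]
      fun t => ∑ r ∈ s, fourierCoeff f r * fourier r t := by
    intro s
    induction s using Finset.induction_on with
    | empty => simp only [Finset.sum_empty]; exact Lp.coeFn_zero ℂ 2 (haarAddCircle (T := 1))
    | insert i s hi ih =>
      rw [Finset.sum_insert hi]
      filter_upwards [Lp.coeFn_add (fourierCoeff f i • fourierLp (T := 1) 2 i)
        (∑ r ∈ s, fourierCoeff f r • fourierLp (T := 1) 2 r), ih,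
        Lp.coeFn_smul (fourierCoeff f i) (fourierLp (T := 1) 2 i),
        coeFn_fourierLp (T := 1) 2 i] with t h1 h2 h3 h4
      rw [h1, Pi.add_apply, h2, h3, Finset.sum_insert hi, Pi.smul_apply, h4, smul_eq_mul]
  have hco : ∀ i, inner ℂ (fourierLp (T := 1) 2 i) hf.toLp = fourierCoeff f i := fun i => by
    have := fourierBasis_repr (hf.toLp) i
    rw [HilbertBasis.repr_apply_apply, coe_fourierBasis] at this
    rw [this]
    exact congrFun (fourierCoeff_congr_ae hf.coeFn_toLp) i
  have hs := hasSum_fourier_series_L2 hf.toLp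
  have hs' : HasSum (fun i => fourierCoeff f i • fourierLp (T := 1) 2 i) hf.toLp := by
    convert hs using 3 with i
    exact (congrFun (fourierCoeff_congr_ae hf.coeFn_toLp) i).symm
  have ht : Tendsto (fun L : ℕ => ∑ r ∈ Finset.Icc (-(L : ℤ)) L,
      fourierCoeff f r • fourierLp (T := 1) 2 r) atTop (𝓝 hf.toLp) :=
    hs'.comp Finset.tendsto_Icc_neg
  have ht2 := (tendsto_iff_edist_tendsto_0.1 ht).eventually (gt_mem_nhds (pos_iff_ne_zero.2 hκ))
  obtain ⟨L, hL⟩ := ht2.exists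
  refine ⟨fourierCoeff f, L, fun s => ?_, ?_⟩
  · rw [← eLpNorm_congr_ae (key s), ← eLpNorm_congr_ae hf.coeFn_toLp, ← Lp.enorm_def,
      ← Lp.enorm_def, enorm_le_iff_norm_le]
    have hb := (orthonormal_fourier (T := 1)).sum_inner_products_le (s := s) hf.toLp
    have : ‖∑ r ∈ s, fourierCoeff f r • fourierLp (T := 1) 2 r‖ ^ 2
        = ∑ r ∈ s, ‖inner ℂ (fourierLp (T := 1) 2 r) hf.toLp‖ ^ 2 := by
      rw [@norm_sq_eq_re_inner ℂ, (orthonormal_fourier (T := 1)).inner_sum, map_sum]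
      refine Finset.sum_congr rfl fun i _ => ?_
      rw [hco, ← Complex.normSq_eq_conj_mul_self]
      rw [Complex.normSq_eq_norm_sq]; exact Complex.ofReal_re _
    exact le_of_sq_le_sq (this ▸ hb) (norm_nonneg _)
  · rw [Lp.edist_def] at hL
    refine le_of_eq_of_le (eLpNorm_congr_ae ?_) hL.le
    filter_upwards [key (Finset.Icc (-(L : ℤ)) L), hf.coeFn_toLp] with t h1 h2
    simp only [Pi.sub_apply, h1, h2]

/-- Multiplication by `fourier s` moves the window `[-L, L]` to `[s - L, s + L]`, which is positive
since `L < s`. Atom indices are one less than their frequencies. -/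
theorem blockSum_shift {a : ℤ → ℂ} {C : ℝ≥0∞} (ha : ∀ s : Finset ℤ,
      eLpNorm (fun t => ∑ r ∈ s, a r * fourier r t) 2 (haarAddCircle (T := 1)) ≤ C) {s L : ℕ} (hL : L < s)
    (d : ℂ) : BlockSum circleAtom (s - L - 1) (s + L) {g | eLpNorm g 2 haarAddCircle ≤ ‖d‖ₑ * C}
      (fun t => d * fourier s t * ∑ r ∈ Finset.Icc (-(L : ℤ)) L, a r * fourier r t) := by
  have key : ∀ u : Finset ℕ, ∑ k ∈ u, (fun t : UnitAddCircle => (d * a ((k : ℤ) + 1 - s)) * fourier ((k : ℤ) + 1) t)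
      = fun t => d * fourier s t * ∑ r ∈ u.image (fun k : ℕ => (k : ℤ) + 1 - s), a r * fourier r t := by
    intro u
    ext t
    rw [Finset.sum_image (fun i _ j _ h => by simpa using h), Finset.sum_apply, Finset.mul_sum]
    refine Finset.sum_congr rfl fun k _ => ?_
    have : fourier ((k : ℤ) + 1) t = fourier s t * fourier ((k : ℤ) + 1 - s) t := by
      rw [← fourier_add]; congr 2; ring
    rw [this]; ring
  refine ⟨by omega, fun k t => (d * a ((k : ℤ) + 1 - s)) * fourier ((k : ℤ) + 1) t,
    fun k => ⟨_, rfl⟩, fun m _ _ => ?_, ?_⟩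
  · rw [key]
    refine le_trans (eLpNorm_le_nnreal_smul_eLpNorm_of_ae_le_mul (c := ‖d‖₊)
      (g := fun t => ∑ r ∈ (Finset.Ico (s - L - 1) m).image (fun k : ℕ => (k : ℤ) + 1 - s), a r * fourier r t) 
      (ae_of_all _ fun t => ?_) 2) ?_
    · rw [nnnorm_mul, nnnorm_mul]
      rw [nnnorm_fourier_apply, mul_one]
    · rw [ENNReal.smul_def, smul_eq_mul]
      exact mul_le_mul_right (ha _) _
  · rw [key]
    congr! 3
    ext r
    simp only [Finset.mem_image, Finset.mem_Ico, Finset.mem_Icc]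
    constructor
    · rintro ⟨k, h, rfl⟩; omega
    · rintro ⟨h1, h2⟩
      exact ⟨(r + s - 1).toNat, by omega, by omega⟩

/-! ### Polynomials close to 1 off a short arc -/

open Polynomial in
theorem exists_polynomial_norm_lt_one {r : ℝ} (hr : 0 < r) : ∃ (q : ℂ[X]) (c : ℝ), 0 ≤ c ∧ c < 1 ∧
    q.eval 0 = 1 ∧ ∀ z : ℂ, ‖z‖ = 1 → r ≤ ‖z - 1‖ → ‖q.eval z‖ ≤ c := by
  obtain ⟨n, hn⟩ := exists_nat_gt (8 / r ^ 2)
  have hn0 : (0 : ℝ) < n := lt_trans (by positivity) hn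
  have hnc : (n : ℂ) ≠ 0 := by exact_mod_cast hn0.ne'
  -- With truncated subtraction the exponent is `|j - k|`. On the unit circle the real part of `A`
  -- is the Fejér kernel, at most `4 / (n r²)` when `r ≤ ‖z - 1‖`; at `0` only the diagonal
  -- contributes.
  set A : ℂ[X] := C (n : ℂ)⁻¹ * ∑ j ∈ Finset.range n, ∑ k ∈ Finset.range n, X ^ ((j - k) + (k - j))
    with hA
  have hA0 : A.eval 0 = 1 := by
    have : ∀ j ∈ Finset.range n, ∑ k ∈ Finset.range n, (0 : ℂ) ^ ((j - k) + (k - j)) = 1 := by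
      intro j hj
      rw [Finset.sum_eq_single j]
      · simp
      · intro k _ hk; exact zero_pow (by omega)
      · intro h; exact absurd hj h
    simp only [hA, eval_mul, eval_C, eval_finsetSum, eval_pow, eval_X]
    rw [Finset.sum_congr rfl this]
    simp [hnc]
  have hAb : ∀ z : ℂ, ‖z‖ = 1 → ‖A.eval z‖ ≤ n := by
    intro z hz
    simp only [hA, eval_mul, eval_C, eval_finsetSum, eval_pow, eval_X, norm_mul, norm_inv,
      Complex.norm_natCast]
    have : ‖∑ j ∈ Finset.range n, ∑ k ∈ Finset.range n, z ^ ((j - k) + (k - j))‖ ≤ n * n := by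
      calc _ ≤ ∑ j ∈ Finset.range n, ∑ k ∈ Finset.range n, (1 : ℝ) :=
            norm_sum_le_of_le _ fun j _ => norm_sum_le_of_le _ fun k _ => by
              rw [norm_pow, hz, one_pow]
        _ = n * n := by simp
    calc (n : ℝ)⁻¹ * _ ≤ (n : ℝ)⁻¹ * (n * n) := by gcongr
      _ = n := by field_simp
  have hAr : ∀ z : ℂ, ‖z‖ = 1 → r ≤ ‖z - 1‖ → (A.eval z).re ≤ 1 / 2 := by
    intro z hz hr'
    have hre : ∀ j k : ℕ, (z ^ ((j - k) + (k - j))).re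
        = (z ^ j * (starRingEnd ℂ) (z ^ k)).re := by
      have hle : ∀ j k : ℕ, j ≤ k → z ^ k * (starRingEnd ℂ) (z ^ j) = z ^ (k - j) := by
        intro j k h
        have h1 : z ^ j * (starRingEnd ℂ) (z ^ j) = 1 := by
          rw [Complex.mul_conj, Complex.normSq_eq_norm_sq, norm_pow, hz]; simp
        calc z ^ k * (starRingEnd ℂ) (z ^ j) = z ^ (k - j) * (z ^ j * (starRingEnd ℂ) (z ^ j)) := by
              rw [← mul_assoc, ← pow_add, Nat.sub_add_cancel h]
          _ = _ := by rw [h1, mul_one]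
      intro j k
      rcases le_total j k with h | h
      · have := hle j k h
        rw [Nat.sub_eq_zero_of_le h, zero_add, ← this, ← Complex.conj_re, map_mul,
          Complex.conj_conj, mul_comm]
      · rw [Nat.sub_eq_zero_of_le h, add_zero, hle k j h]
    have hsum : (A.eval z).re = (n : ℝ)⁻¹ * ‖∑ j ∈ Finset.range n, z ^ j‖ ^ 2 := by
      have e : (A.eval z) = ((n : ℝ)⁻¹ : ℝ) * ∑ j ∈ Finset.range n, ∑ k ∈ Finset.range n,
          z ^ ((j - k) + (k - j)) := by
        simp [hA, eval_finsetSum]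
      rw [e, Complex.re_ofReal_mul, Complex.re_sum]
      congr 1
      rw [← Complex.normSq_eq_norm_sq, ← Complex.ofReal_re (Complex.normSq _), ← Complex.mul_conj,
        map_sum, Finset.sum_mul_sum, Complex.re_sum]
      refine Finset.sum_congr rfl fun j _ => ?_
      rw [Complex.re_sum, Complex.re_sum]
      exact Finset.sum_congr rfl fun k _ => hre j k
    have hg := congrArg norm (geom_sum_mul z n)
    rw [norm_mul] at hg
    have h2 : ‖z ^ n - 1‖ ≤ 2 := by
      refine (norm_sub_le _ _).trans ?_
      rw [norm_pow, hz]; norm_num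
    have h3 : ‖∑ j ∈ Finset.range n, z ^ j‖ * r ≤ 2 := by
      refine le_trans ?_ (hg.trans_le h2)
      gcongr
    have h4 : ‖∑ j ∈ Finset.range n, z ^ j‖ ^ 2 * r ^ 2 ≤ 4 := by
      rw [← mul_pow]
      calc _ ≤ (2 : ℝ) ^ 2 := by gcongr
        _ = 4 := by norm_num
    rw [hsum, inv_mul_le_iff₀ hn0]
    rw [div_lt_iff₀ (by positivity)] at hn
    have hr2 : 0 < r ^ 2 := by positivity
    by_contra hcon
    push Not at hcon
    nlinarith
  set S : ℝ := 1 + n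
  have hS : 0 < S := by positivity
  -- For `W = 1 - A` with `1/2 ≤ Re W` and `‖W‖ ≤ S`, one has `‖1 - εW‖² ≤ 1 - ε + ε²S²`; the choice
  -- `ε = 1/(2S²)` minimises the right side.
  refine ⟨1 - C ((1 / (2 * S ^ 2) : ℝ) : ℂ) * (1 - A), √(1 - 1 / (4 * S ^ 2)), Real.sqrt_nonneg _, ?_, ?_,
    fun z hz hr' => ?_⟩
  · rw [Real.sqrt_lt' one_pos]
    have : 0 < 1 / (4 * S ^ 2) := by positivity
    linarith
  · simp [hA0]
  · set W : ℂ := 1 - A.eval z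
    have hW : ‖W‖ ≤ S := (norm_sub_le _ _).trans (by simpa [S] using hAb z hz)
    have hWr : 1 / 2 ≤ W.re := by
      have := hAr z hz hr'
      simp only [W, Complex.sub_re, Complex.one_re]; linarith
    apply Real.le_sqrt_of_sq_le
    simp only [eval_sub, eval_one, eval_mul, eval_C]
    change ‖1 - ((1 / (2 * S ^ 2) : ℝ) : ℂ) * W‖ ^ 2 ≤ _
    generalize hε : (1 / (2 * S ^ 2) : ℝ) = ε
    have hε0 : 0 < ε := by rw [← hε]; positivity
    have hW2 : ‖W‖ ^ 2 ≤ S ^ 2 := by gcongr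
    have : ‖1 - (ε : ℂ) * W‖ ^ 2 = 1 - 2 * ε * W.re + ε ^ 2 * ‖W‖ ^ 2 := by
      rw [← Complex.normSq_eq_norm_sq, ← Complex.normSq_eq_norm_sq]
      simp [Complex.normSq_apply]; ring
    rw [this]
    calc 1 - 2 * ε * W.re + ε ^ 2 * ‖W‖ ^ 2 ≤ 1 - 2 * ε * (1 / 2) + ε ^ 2 * S ^ 2 := by gcongr
      _ = 1 - 1 / (4 * S ^ 2) := by rw [← hε]; field_simp; ring

open Polynomial in
-- The polynomial is `1 - q ^ n`: powers of `q` decay uniformly off the arc, and `q(0) = 1` removes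
-- the constant term, so only positive frequencies occur. Nothing is claimed on the arc itself.
theorem exists_polynomial_near_one {δ ρ : ℝ} (hδ : 0 < δ) (hρ : 0 < ρ) : ∃ p : ℂ[X],
    p.coeff 0 = 0 ∧ ∀ t : UnitAddCircle, t ∉ Metric.closedBall 0 ρ →
      ‖p.eval (fourier 1 t) - 1‖ ≤ δ := by
  have hK : IsCompact (Metric.ball (0 : UnitAddCircle) ρ)ᶜ := Metric.isOpen_ball.isClosed_compl.isCompact
  obtain ⟨r, hr, hrK⟩ := hK.exists_forall_le' (f := fun t => ‖fourier 1 t - 1‖) (a := 0)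
    (Continuous.continuousOn (by fun_prop)) (fun t ht => by
      rw [norm_pos_iff, sub_ne_zero]
      intro h
      rw [fourier_one] at h
      have h' : (AddCircle.toCircle t) = AddCircle.toCircle (0 : UnitAddCircle) := by
        ext; rw [h]; simp
      have := AddCircle.injective_toCircle one_ne_zero h'
      subst this
      exact ht (Metric.mem_ball_self hρ))
  obtain ⟨q, c, hc0, hc1, hq0, hq⟩ := exists_polynomial_norm_lt_one hr
  obtain ⟨n, hn⟩ := exists_pow_lt_of_lt_one hδ hc1
  refine ⟨1 - q ^ n, by rw [coeff_zero_eq_eval_zero]; simp [hq0], fun t ht => ?_⟩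
  have h1 : ‖q.eval (fourier 1 t)‖ ≤ c := by
    refine hq _ ?_ (hrK t fun h => ht (Metric.ball_subset_closedBall h))
    rw [fourier_one]; exact Circle.norm_coe _
  calc ‖(1 - q ^ n).eval (fourier 1 t) - 1‖ = ‖q.eval (fourier 1 t)‖ ^ n := by
        simp [eval_pow]
    _ ≤ c ^ n := by gcongr
    _ ≤ δ := hn.le

/-! ### Blocks approximating 1 on the circle off a small set -/

/-- The closed `L²(μ)`-ball of radius `C`, as a set of functions. -/
def l2Ball {α : Type*} [MeasurableSpace α] (μ : Measure α) (C : ℝ≥0∞) : Set (α → ℂ) :=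
  {g | AEStronglyMeasurable g μ ∧ eLpNorm g 2 μ ≤ C}

theorem l2Ball_mono {α : Type*} [MeasurableSpace α] {μ ν : Measure α} {C D : ℝ≥0∞} (h : ν ≤ μ)
    (hC : C ≤ D) : l2Ball μ C ⊆ l2Ball ν D := fun _ hg =>
  ⟨hg.1.mono_measure h, (eLpNorm_mono_measure _ h).trans (hg.2.trans hC)⟩

theorem blockSum_shift_l2Ball {a : ℤ → ℂ} {C : ℝ≥0∞} (ha : ∀ s : Finset ℤ,
      eLpNorm (fun t => ∑ r ∈ s, a r * fourier r t) 2 (haarAddCircle (T := 1)) ≤ C) {s L : ℕ}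
    (hL : L < s) (d : ℂ) :
    BlockSum circleAtom (s - L - 1) (s + L) (l2Ball haarAddCircle (‖d‖ₑ * C))
      (fun t => d * fourier s t * ∑ r ∈ Finset.Icc (-(L : ℤ)) L, a r * fourier r t) := by
  obtain ⟨h0, y, h1, h2, h3⟩ := blockSum_shift ha hL d
  refine ⟨h0, y, h1, fun m u v => ⟨?_, h2 m u v⟩, h3⟩
  refine Finset.aestronglyMeasurable_sum _ fun k _ => ?_
  obtain ⟨c, hc⟩ := h1 k
  rw [hc]
  exact Continuous.aestronglyMeasurable (by fun_prop)

theorem eLpNorm_mul_le_of_enorm_le {α : Type*} [MeasurableSpace α] {μ : Measure α} {f g : α → ℂ}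
    {M : ℝ≥0∞} (hMt : M ≠ ⊤) (hM : ∀ t, ‖g t‖ₑ ≤ M) :
    eLpNorm (fun t => g t * f t) 2 μ ≤ M * eLpNorm f 2 μ := by
  lift M to NNReal using hMt
  refine eLpNorm_le_nnreal_smul_eLpNorm_of_ae_le_mul (ae_of_all _ fun t => ?_) 2
  rw [nnnorm_mul]
  gcongr
  exact_mod_cast hM t

/-- The polynomial places copies of the Fourier window of `f` at the multiples of `m`. An unfinished
sum is a truncation of the polynomial times the window, plus part of one further copy; each is at
most `M` times the norm of `f`. The spacing `m` precedes the rotation `w`, which is later selected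
by an average depending on `m`. -/
theorem exists_blockSum_mul {f : UnitAddCircle → ℂ} (hf : MemLp f 2 haarAddCircle)
    {p : Polynomial ℂ} (hp : p.coeff 0 = 0) {M : ℝ≥0∞} (hM : ∑ i ∈ Finset.range (p.natDegree + 1), ‖p.coeff i‖ₑ ≤ M) 
    (hMt : M ≠ ⊤)
    {κ : ℝ≥0∞} (hκ : κ ≠ 0) (N : ℕ) : ∃ m : ℕ, ∀ w : ℂ, ‖w‖ = 1 → ∃ N' x,
      BlockSum circleAtom N N' (l2Ball haarAddCircle (2 * M * eLpNorm f 2 haarAddCircle)) x ∧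
      eLpNorm (fun t => x t - p.eval (w * fourier m t) * f t) 2 haarAddCircle ≤ κ := by
  obtain ⟨a, L, ha, hκL⟩ := exists_fourier_partial_sum hf
    (κ := κ / (M + 1)) (ENNReal.div_ne_zero.2 ⟨hκ, ENNReal.add_ne_top.2 ⟨hMt, ENNReal.one_ne_top⟩⟩)
  set χ : UnitAddCircle → ℂ := fun t => ∑ r ∈ Finset.Icc (-(L : ℤ)) L, a r * fourier r t with hχ
  set F := eLpNorm f 2 (haarAddCircle (T := 1))
  -- More than `2L`, so that successive windows are disjoint, and large enough for the first one to
  -- lie above `N`.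
  set m := N + 2 * L + 2
  refine ⟨m, fun w hw => ?_⟩
  have hwn : ∀ n : ℕ, ‖w ^ n‖ₑ = 1 := fun n => by
    rw [← ofReal_norm, norm_pow, hw]; simp
  have hcoef : ∀ i, i ≤ p.natDegree → ‖p.coeff i‖ₑ ≤ M := fun i hi =>
    (Finset.single_le_sum (f := fun i => ‖p.coeff i‖ₑ) (fun _ _ => zero_le)
      (Finset.mem_range.2 (Nat.lt_succ_of_le hi))).trans hM
  have hpart : ∀ n ≤ p.natDegree, ∀ t : UnitAddCircle,
      ‖∑ i ∈ Finset.range (n + 1), p.coeff i * (w * fourier (m : ℤ) t) ^ i‖ₑ ≤ M := by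
    intro n hn t
    refine (enorm_sum_le _ _).trans (le_trans ?_ hM)
    refine (Finset.sum_le_sum_of_subset (Finset.range_mono (Nat.succ_le_succ hn))).trans' ?_
    refine Finset.sum_le_sum fun i _ => ?_
    rw [mul_pow, enorm_mul, enorm_mul, hwn, enorm_pow]
    rw [show ‖fourier (m : ℤ) t‖ₑ = 1 by rw [enorm_eq_nnnorm, nnnorm_fourier_apply]; simp]
    simp
  have hind : ∀ n ≤ p.natDegree, BlockSum circleAtom N ((n + 1) * m - L - 1)
      (l2Ball haarAddCircle (2 * M * F))
      (fun t => (∑ i ∈ Finset.range (n + 1), p.coeff i * (w * fourier (m : ℤ) t) ^ i) * χ t) := by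
    intro n
    induction n with
    | zero =>
      intro _
      have e : (fun t => (∑ i ∈ Finset.range (0 + 1), p.coeff i * (w * fourier (m : ℤ) t) ^ i) * χ t) = 0 := by
        ext t; simp [hp]
      rw [e]
      refine (BlockSum.zero zero_mem_circleAtom (by omega)).mono ?_
      rintro _ rfl
      exact ⟨aestronglyMeasurable_zero, by simp⟩
    | succ n ih =>
      intro hn
      have hs : L < (n + 1) * m := lt_of_lt_of_le (by omega : L < m) (Nat.le_mul_of_pos_left _ (by omega))
      have hb := blockSum_shift_l2Ball ha hs (p.coeff (n + 1) * w ^ (n + 1))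
      have hfm : ∀ t : UnitAddCircle, fourier (((n + 1) * m : ℕ) : ℤ) t = fourier (m : ℤ) t ^ (n + 1) := by
        intro t
        rw [fourier_apply, fourier_apply, ← Circle.coe_pow, ← AddCircle.toCircle_nsmul, ← natCast_zsmul,
          ← mul_smul]
        norm_cast
      have hend : (n + 1) * m + L ≤ (n + 1 + 1) * m - L - 1 := by
        have : (n + 1 + 1) * m = (n + 1) * m + m := by ring
        omega
      have e : (fun t => (∑ i ∈ Finset.range (n + 1 + 1), p.coeff i * (w * fourier (m : ℤ) t) ^ i) * χ t)
          = (fun t => (∑ i ∈ Finset.range (n + 1), p.coeff i * (w * fourier (m : ℤ) t) ^ i) * χ t)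
            + (fun t => p.coeff (n + 1) * w ^ (n + 1) * fourier (((n + 1) * m : ℕ) : ℤ) t * χ t) := by
        ext t
        rw [Finset.sum_range_succ, add_mul, Pi.add_apply, hfm, mul_pow]
        ring
      rw [e]
      refine (BlockSum.concat (ih (by omega)) hb subset_rfl fun z hz => ⟨?_, ?_⟩).pad zero_mem_circleAtom hend
      · exact (Continuous.aestronglyMeasurable (by fun_prop)).add hz.1
      · refine (eLpNorm_add_le (Continuous.aestronglyMeasurable (by fun_prop)) hz.1 (by norm_num)).trans ?_
        rw [two_mul, add_mul]
        refine add_le_add ((eLpNorm_mul_le_of_enorm_le hMt (hpart n (by omega))).trans ?_) (hz.2.trans ?_)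
        · gcongr; exact ha _
        · rw [enorm_mul, hwn, mul_one]; gcongr; exact hcoef _ hn
  have h1 := hind _ le_rfl
  refine ⟨_, _, h1, ?_⟩
  have e : (fun t => (∑ i ∈ Finset.range (p.natDegree + 1), p.coeff i * (w * fourier (m : ℤ) t) ^ i) * χ t
      - p.eval (w * fourier m t) * f t) = fun t => p.eval (w * fourier m t) * (χ t - f t) := by
    ext t
    rw [← Polynomial.eval_eq_sum_range, mul_sub]
  rw [e]
  refine (eLpNorm_mul_le_of_enorm_le hMt fun t => ?_).trans ?_
  · rw [Polynomial.eval_eq_sum_range]; exact hpart _ le_rfl t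
  · calc M * _ ≤ (M + 1) * (κ / (M + 1)) := mul_le_mul' le_self_add hκL
      _ ≤ κ := ENNReal.mul_div_le

/-- For fixed `t` the point `θ + m • t` is Haar distributed in `θ`, so by Fubini the mean over `θ`
of the left side is the right side. -/
theorem exists_translate_measure_inter_le {A E : Set UnitAddCircle}
    (hA : MeasurableSet A) (m : ℕ) : ∃ θ : UnitAddCircle,
      haarAddCircle (E ∩ {t | θ + m • t ∈ A}) ≤ haarAddCircle E * haarAddCircle A := by
  have hmeas : Measurable fun q : UnitAddCircle × UnitAddCircle =>
      A.indicator (1 : UnitAddCircle → ℝ≥0∞) (q.1 + m • q.2) :=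
    (measurable_one.indicator hA).comp (by fun_prop)
  obtain ⟨θ, hθ⟩ := exists_le_lintegral (μ := (haarAddCircle (T := 1)))
    (f := fun θ => ∫⁻ t in E, A.indicator (1 : UnitAddCircle → ℝ≥0∞) (θ + m • t) ∂haarAddCircle)
    (Measurable.lintegral_prod_right hmeas).aemeasurable
  refine ⟨θ, ?_⟩
  rw [lintegral_lintegral_swap hmeas.aemeasurable] at hθ
  have h1 : ∀ t : UnitAddCircle, ∫⁻ θ, A.indicator (1 : UnitAddCircle → ℝ≥0∞) (θ + m • t)
      ∂haarAddCircle = haarAddCircle A := fun t => by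
    rw [lintegral_add_right_eq_self (μ := haarAddCircle) (A.indicator (1 : UnitAddCircle → ℝ≥0∞)), lintegral_indicator_one hA]
  simp only [h1, setLIntegral_const] at hθ
  rw [mul_comm]
  refine le_trans (le_of_eq ?_) hθ
  have hD : MeasurableSet {t : UnitAddCircle | θ + m • t ∈ A} := 
    (show Measurable fun t : UnitAddCircle => θ + m • t by fun_prop) hA
  rw [Set.inter_comm, ← Measure.restrict_apply hD, ← lintegral_indicator_one hD]
  rfl

/-- The function `1` is built one piece `U (j + 1) \ U j` at a time. Off `B` the finished part is
within `j * κ` of `F`, which is bounded by `2` there; hence the possibly huge `M` multiplies only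
the norm `σ` of the piece in progress. -/
theorem exists_blockSum_mono_family {p : Polynomial ℂ} (hp : p.coeff 0 = 0) {A : Set UnitAddCircle} {δ : ℝ}
    (hδ : δ ≤ 1) (hA : MeasurableSet A) (hpA : ∀ t, t ∉ A → ‖p.eval (fourier 1 t) - 1‖ ≤ δ)
    {M : ℝ≥0∞} (hM : ∑ i ∈ Finset.range (p.natDegree + 1), ‖p.coeff i‖ₑ ≤ M) (hMt : M ≠ ⊤)
    {U : ℕ → Set UnitAddCircle} (hU : ∀ j, MeasurableSet (U j)) (hUm : Monotone U) (hU0 : haarAddCircle (U 0) = 0)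
    {σ : ℝ≥0∞} (hσ : ∀ j, haarAddCircle (U (j + 1) \ U j) ≤ σ ^ 2) {κ : ℝ≥0∞} (hκ : κ ≠ 0) (N j : ℕ) :
    ∃ N' x B F, MeasurableSet B ∧ haarAddCircle B ≤ haarAddCircle (U j) * haarAddCircle A ∧
      Measurable F ∧ (∀ t, t ∉ U j → F t = 0) ∧ (∀ t, t ∈ U j → t ∉ B → ‖F t - 1‖ ≤ δ) ∧
      eLpNorm (x - F) 2 haarAddCircle ≤ j * κ ∧
      BlockSum circleAtom N N' (l2Ball (haarAddCircle.restrict Bᶜ) (j * κ + 2 + 2 * M * σ)) x := by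
  induction j with
  | zero =>
    refine ⟨N, 0, U 0, 0, hU 0, by simp [hU0], measurable_zero, fun _ _ => rfl, fun t h h' => absurd h h',
      by simp, (BlockSum.zero zero_mem_circleAtom le_rfl).mono ?_⟩
    rintro _ rfl
    exact ⟨aestronglyMeasurable_zero, by simp⟩
  | succ j ih =>
    obtain ⟨N₁, x, B, F, hB, hBm, hF, hF0, hF1, hxF, hblk⟩ := ih
    set E := U (j + 1) \ U j with hE
    have hEm : MeasurableSet E := (hU _).diff (hU _)
    set f : UnitAddCircle → ℂ := E.indicator 1 with hf
    have hfL : MemLp f 2 haarAddCircle := (memLp_const (1 : ℂ)).indicator hEm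
    have hfn : eLpNorm f 2 haarAddCircle ≤ σ := by
      have := eLpNorm_indicator_const_le (μ := haarAddCircle (T := 1)) (s := E) (1 : ℂ) 2
      refine this.trans ?_
      rw [enorm_one, one_mul]
      calc haarAddCircle E ^ (1 / (2 : ℝ≥0∞).toReal) ≤ (σ ^ 2) ^ (1 / (2 : ℝ≥0∞).toReal) := by
            gcongr; exact hσ j
        _ = σ := by
            rw [← ENNReal.rpow_natCast, ← ENNReal.rpow_mul]; simp
    obtain ⟨m, hm⟩ := exists_blockSum_mul hfL hp hM hMt hκ N₁
    obtain ⟨θ, hθ⟩ := exists_translate_measure_inter_le (E := E) hA m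
    obtain ⟨N₂, y, hy, hyκ⟩ := hm (fourier 1 θ) (by rw [fourier_one]; exact Circle.norm_coe _)
    set D := {t : UnitAddCircle | θ + m • t ∈ A} with hD
    have hDm : MeasurableSet D := (show Measurable fun t : UnitAddCircle => θ + m • t by fun_prop) hA
    have hpe : ∀ t : UnitAddCircle, fourier 1 θ * fourier (m : ℤ) t = fourier 1 (θ + m • t) := by
      intro t
      rw [fourier_apply, fourier_apply, fourier_apply, one_zsmul, one_zsmul, natCast_zsmul,
        AddCircle.toCircle_add, Circle.coe_mul]
    have hPm : Measurable fun t : UnitAddCircle => p.eval (fourier 1 θ * fourier (m : ℤ) t) * f t := by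
      refine Measurable.mul (Continuous.measurable ?_) (measurable_one.indicator hEm)
      exact p.continuous.comp (by fun_prop)
    refine ⟨N₂, x + y, B ∪ (E ∩ D), F + fun t => p.eval (fourier 1 θ * fourier (m : ℤ) t) * f t,
      hB.union (hEm.inter hDm), ?_, hF.add hPm, ?_, ?_, ?_, ?_⟩
    · have : haarAddCircle (U (j + 1)) = haarAddCircle (U j) + haarAddCircle E := by
        rw [← measure_sdiff_add_inter (U (j + 1)) (hU j),
          Set.inter_eq_self_of_subset_right (hUm (Nat.le_succ j)), add_comm]
      rw [this, add_mul]
      exact (measure_union_le _ _).trans (add_le_add hBm hθ)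
    · intro t ht
      have h1 : t ∉ U j := fun h => ht (hUm (Nat.le_succ j) h)
      have h2 : t ∉ E := fun h => ht h.1
      simp [hF0 t h1, hf, h2]
    · intro t ht htB
      rw [Set.mem_union, not_or] at htB
      by_cases h : t ∈ U j
      · have h2 : t ∉ E := fun h' => h'.2 h
        simpa [hf, h2] using hF1 t h htB.1
      · have h2 : t ∈ E := ⟨ht, h⟩
        have h3 : θ + m • t ∉ A := fun h' => htB.2 ⟨h2, h'⟩
        have h4 : (F + fun t => p.eval (fourier 1 θ * fourier (m : ℤ) t) * f t) t
            = p.eval (fourier 1 (θ + m • t)) := by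
          rw [Pi.add_apply, hF0 t h, hpe, hf, Set.indicator_of_mem h2]
          simp
        rw [h4]
        exact hpA _ h3
    · have e : (x + y - (F + fun t => p.eval (fourier 1 θ * fourier (m : ℤ) t) * f t))
        = (x - F) + fun t => y t - p.eval (fourier 1 θ * fourier (m : ℤ) t) * f t := by
        ext t; simp; ring
      have hxm : AEStronglyMeasurable x haarAddCircle := by
        obtain ⟨_, z, h1, _, h3⟩ := hblk
        rw [← h3]
        refine Finset.aestronglyMeasurable_sum _ fun k _ => ?_
        obtain ⟨c, hc⟩ := h1 k
        rw [hc]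
        exact Continuous.aestronglyMeasurable (by fun_prop)
      rw [e]
      refine (eLpNorm_add_le (hxm.sub hF.aestronglyMeasurable)
        (hy.mem.1.sub hPm.aestronglyMeasurable) (by norm_num)).trans ?_
      push_cast
      rw [add_mul, one_mul]
      exact add_le_add hxF hyκ
    · have hsub : haarAddCircle.restrict (B ∪ (E ∩ D))ᶜ ≤ (haarAddCircle (T := 1)).restrict Bᶜ :=
        Measure.restrict_mono (Set.compl_subset_compl.2 Set.subset_union_left) le_rfl
      have hCle : (j : ℝ≥0∞) * κ ≤ ((j + 1 : ℕ) : ℝ≥0∞) * κ := by gcongr; simp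
      refine hblk.concat hy (l2Ball_mono hsub (by gcongr)) fun z hz => ⟨?_, ?_⟩
      · exact (hblk.mem.1.mono_measure hsub).add (hz.1.mono_measure Measure.restrict_le_self)
      · refine (eLpNorm_mono_measure _ hsub).trans ?_
        have hxF' : AEStronglyMeasurable (x - F) (haarAddCircle.restrict Bᶜ) :=
          hblk.mem.1.sub hF.aestronglyMeasurable
        have hzm : AEStronglyMeasurable z (haarAddCircle.restrict Bᶜ) := hz.1.mono_measure Measure.restrict_le_self
        have e : x + z = (x - F) + F + z := by simp
        rw [e]
        refine (eLpNorm_add_le (hxF'.add hF.aestronglyMeasurable) hzm (by norm_num)).trans ?_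
        refine add_le_add ((eLpNorm_add_le hxF' hF.aestronglyMeasurable (by norm_num)).trans
          (add_le_add ?_ ?_)) ?_
        · exact ((eLpNorm_mono_measure _ Measure.restrict_le_self).trans hxF).trans hCle
        · have hb : ∀ᵐ t ∂(haarAddCircle.restrict Bᶜ), ‖F t‖ ≤ 2 := by
            filter_upwards [ae_restrict_mem hB.compl] with t ht
            by_cases h : t ∈ U j
            · have := hF1 t h ht
              calc ‖F t‖ = ‖(F t - 1) + 1‖ := by simp
                _ ≤ ‖F t - 1‖ + ‖(1 : ℂ)‖ := norm_add_le _ _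
                _ ≤ 2 := by rw [norm_one]; linarith
            · simp [hF0 t h]
          refine (eLpNorm_le_of_ae_bound hb).trans ?_
          have h1 : haarAddCircle.restrict Bᶜ Set.univ ≤ 1 := by
            rw [Measure.restrict_apply_univ]; exact prob_le_one
          calc _ ≤ 1 * ENNReal.ofReal 2 := by
                gcongr; exact ENNReal.rpow_le_one h1 (by positivity)
            _ = 2 := by simp
        · refine ((eLpNorm_mono_measure _ Measure.restrict_le_self).trans hz.2).trans ?_
          gcongr

theorem volume_eq_haarAddCircle : (volume : Measure UnitAddCircle) = haarAddCircle := by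
  have := AddCircle.volume_eq_smul_haarAddCircle (T := 1)
  simpa using this

theorem exists_circle_block {ε : ℝ} (hε : 0 < ε) (N : ℕ) : ∃ N' x B, MeasurableSet B ∧
    haarAddCircle B ≤ ENNReal.ofReal ε ∧
    eLpNorm (x - 1) 2 (haarAddCircle.restrict Bᶜ) ≤ ENNReal.ofReal ε ∧
    BlockSum circleAtom N N' (l2Ball (haarAddCircle.restrict Bᶜ) 4) x := by
  set δ := min (ε / 2) 1 with hδ
  have hδ0 : 0 < δ := lt_min (by positivity) one_pos
  obtain ⟨p, hp0, hp⟩ := exists_polynomial_near_one hδ0 (ρ := ε / 2) (by positivity)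
  set Mr : ℝ := ∑ i ∈ Finset.range (p.natDegree + 1), ‖p.coeff i‖
  have hMr : 0 ≤ Mr := Finset.sum_nonneg fun _ _ => norm_nonneg _
  have hM : ∑ i ∈ Finset.range (p.natDegree + 1), ‖p.coeff i‖ₑ ≤ ENNReal.ofReal Mr := by
    rw [ENNReal.ofReal_sum_of_nonneg fun _ _ => norm_nonneg _]
    simp
  -- Pieces of measure at most `s²` satisfy `2 * Mr * s ≤ 1`; the final bound is then `1 + 2 + 1 =
  -- 4`, whatever the polynomial.
  set s : ℝ := 1 / (2 * Mr + 1)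
  have hs : 0 < s := by positivity
  have hvol : ∀ r : ℝ, haarAddCircle (Metric.closedBall (0 : UnitAddCircle) r)
      = ENNReal.ofReal (min 1 (2 * r)) := fun r => by
    rw [← volume_eq_haarAddCircle, AddCircle.volume_closedBall]
  set U : ℕ → Set UnitAddCircle := fun j => Metric.closedBall 0 (j * (s ^ 2 / 2)) with hU
  have hUm : ∀ j, MeasurableSet (U j) := fun j => Metric.isClosed_closedBall.measurableSet
  have hUmono : Monotone U := fun i j h => Metric.closedBall_subset_closedBall (by gcongr)
  -- The radius `J * (s² / 2)` is at least `1/2`, the largest norm on the circle, so `U J` is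
  -- everything.
  obtain ⟨J, hJ⟩ := exists_nat_ge (1 / s ^ 2)
  have hJU : ∀ t, t ∈ U J := fun t => by
    rw [hU, mem_closedBall_zero_iff]
    have := AddCircle.norm_le_half_period (1 : ℝ) (x := t) one_ne_zero
    rw [div_le_iff₀ (by positivity)] at hJ
    rw [abs_one] at this
    linarith
  obtain ⟨N', x, B, F, hB, hBm, hF, -, hF1, hxF, hblk⟩ := exists_blockSum_mono_family (σ := ENNReal.ofReal s)
    hp0 (min_le_right _ _) Metric.isClosed_closedBall.measurableSet hp hM ENNReal.ofReal_ne_top hUm hUmono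
    (by rw [hU]; dsimp only; rw [hvol]; simp) (fun j => by
      rw [measure_sdiff (hUmono (Nat.le_succ j)) (hUm j).nullMeasurableSet (measure_ne_top _ _), hvol, hvol,
        tsub_le_iff_right, ← ENNReal.ofReal_pow hs.le, ← ENNReal.ofReal_add (by positivity) (by positivity)]
      apply ENNReal.ofReal_le_ofReal
      push_cast
      rcases le_total 1 (2 * (j * (s ^ 2 / 2))) with h | h
      · rw [min_eq_left h]
        exact (min_le_left _ _).trans (by nlinarith)
      · rw [min_eq_right h]
        exact (min_le_right _ _).trans (by nlinarith))
    (κ := ENNReal.ofReal (δ / (J + 1))) (by rw [Ne, ENNReal.ofReal_eq_zero, not_le]; positivity) N J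
  have hJκ : (J : ℝ≥0∞) * ENNReal.ofReal (δ / (J + 1)) ≤ ENNReal.ofReal δ := by
    rw [← ENNReal.ofReal_natCast, ← ENNReal.ofReal_mul (by positivity)]
    apply ENNReal.ofReal_le_ofReal
    rw [mul_div_assoc', div_le_iff₀ (by positivity)]
    nlinarith
  refine ⟨N', x, B, hB, ?_, ?_, hblk.mono (l2Ball_mono le_rfl ?_)⟩
  · refine hBm.trans ?_
    calc _ ≤ 1 * ENNReal.ofReal ε := by
          gcongr
          · exact prob_le_one
          · rw [hvol]; exact ENNReal.ofReal_le_ofReal ((min_le_right _ _).trans (by linarith))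
      _ = _ := one_mul _
  · have hxF' : AEStronglyMeasurable (x - F) (haarAddCircle.restrict Bᶜ) :=
      hblk.mem.1.sub hF.aestronglyMeasurable
    have e : x - 1 = (x - F) + (F - 1) := by simp
    rw [e]
    refine (eLpNorm_add_le hxF' (hF.sub measurable_one).aestronglyMeasurable (by norm_num)).trans ?_
    have h1 : eLpNorm (F - 1) 2 (haarAddCircle.restrict Bᶜ) ≤ ENNReal.ofReal δ := by
      have hb : ∀ᵐ t ∂(haarAddCircle.restrict Bᶜ), ‖(F - 1) t‖ ≤ δ := by
        filter_upwards [ae_restrict_mem hB.compl] with t ht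
        exact hF1 t (hJU t) ht
      refine (eLpNorm_le_of_ae_bound hb).trans ?_
      have h1 : haarAddCircle.restrict Bᶜ Set.univ ≤ 1 := by
        rw [Measure.restrict_apply_univ]; exact prob_le_one
      calc _ ≤ 1 * ENNReal.ofReal δ := by
            gcongr; exact ENNReal.rpow_le_one h1 (by positivity)
        _ = _ := one_mul _
    calc _ ≤ ENNReal.ofReal δ + ENNReal.ofReal δ :=
          add_le_add (((eLpNorm_mono_measure _ Measure.restrict_le_self).trans hxF).trans hJκ) h1
      _ = ENNReal.ofReal (δ + δ) := (ENNReal.ofReal_add hδ0.le hδ0.le).symm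
      _ ≤ _ := ENNReal.ofReal_le_ofReal (by linarith [min_le_left (ε / 2) 1])
  · calc _ ≤ ENNReal.ofReal 1 + 2 + ENNReal.ofReal 1 := by
          gcongr
          · exact hJκ.trans (ENNReal.ofReal_le_ofReal (min_le_right _ _))
          · rw [show (2 : ℝ≥0∞) = ENNReal.ofReal 2 by simp, ← ENNReal.ofReal_mul (by norm_num),
              ← ENNReal.ofReal_mul (by positivity)]
            apply ENNReal.ofReal_le_ofReal
            rw [mul_one_div, div_le_one (by positivity)]
            linarith
      _ = 4 := by simp; norm_num

/-! ### From the circle to weighted spaces on the line -/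

namespace BlockSum

theorem inter {X : Type*} [AddCommMonoid X] {T : ℕ → Set X} {N N' : ℕ} {S : Set X} {x : X}
    (h : BlockSum T N N' S x) (V : AddSubmonoid X) (hV : ∀ k, T k ⊆ V) :
    BlockSum T N N' (S ∩ V) x := by
  obtain ⟨h0, y, h1, h2, h3⟩ := h
  exact ⟨h0, y, h1, fun m a b => ⟨h2 m a b, V.sum_mem fun k _ => hV k (h1 k)⟩, h3⟩

theorem exists_bound {α : Type*} {T : ℕ → Set (α → ℂ)} {N N' : ℕ} {S : Set (α → ℂ)} {x : α → ℂ}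
    (h : BlockSum T N N' S x) (hT : ∀ k, ∀ f ∈ T k, ∃ C : ℝ, ∀ t, ‖f t‖ ≤ C) :
    ∃ C : ℝ, BlockSum T N N' (S ∩ {g | ∀ t, ‖g t‖ ≤ C}) x := by
  obtain ⟨h0, y, h1, h2, h3⟩ := h
  choose C hC using fun k => hT k _ (h1 k)
  refine ⟨∑ k ∈ Finset.Ico N N', |C k|, h0, y, h1, fun m a b => ⟨h2 m a b, fun t => ?_⟩, h3⟩
  rw [Finset.sum_apply]
  refine (norm_sum_le_of_le _ fun k _ => (hC k t).trans (le_abs_self _)).trans ?_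
  exact Finset.sum_le_sum_of_subset_of_nonneg (Finset.Ico_subset_Ico_right b)
    fun _ _ _ => abs_nonneg _

end BlockSum

/-- The exponential `t ↦ exp (2 π i a t)`. -/
noncomputable def expo (a t : ℝ) : ℂ := Complex.exp (2 * Real.pi * Complex.I * a * t)

theorem continuous_expo (a : ℝ) : Continuous (expo a) := by
  unfold expo; fun_prop

theorem norm_expo (a t : ℝ) : ‖expo a t‖ = 1 := by
  rw [expo, show (2 * Real.pi * Complex.I * a * t : ℂ) = ((2 * Real.pi * a * t : ℝ) : ℂ) * Complex.I by
    push_cast; ring]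
  exact Complex.norm_exp_ofReal_mul_I _

theorem expo_add (a b t : ℝ) : expo (a + b) t = expo a t * expo b t := by
  rw [expo, expo, expo, ← Complex.exp_add]; congr 1; push_cast; ring

theorem fourier_coe_eq_expo (n : ℤ) (t : ℝ) : fourier n (t : UnitAddCircle) = expo n t := by
  rw [fourier_coe_apply, expo]; congr 1; push_cast; ring

/-- Multiples of exponentials whose frequency is a small perturbation of `k + 1`. -/
def lineAtom (η : ℝ) (k : ℕ) : Set (ℝ → ℂ) :=
  {f | ∃ (c : ℂ) (a : ℝ), 0 < a ∧ a < η ∧ f = fun t => c * expo (k + 1 + a) t}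

theorem zero_mem_lineAtom {η : ℝ} (hη : 0 < η) (k : ℕ) : (0 : ℝ → ℂ) ∈ lineAtom η k :=
  ⟨0, η / 2, by positivity, by linarith, by ext; simp⟩

theorem circleAtom_subset_continuous (k : ℕ) : circleAtom k ⊆ continuousAddSubmonoid UnitAddCircle ℂ := by
  rintro _ ⟨c, rfl⟩
  exact continuous_const.mul (ContinuousMap.continuous _)

/-- The Gaussian `t ↦ exp (- t²)`. -/
noncomputable def gaussianWeight (t : ℝ) : ℝ := Real.exp (-t ^ 2)

theorem continuous_gaussianWeight : Continuous gaussianWeight := by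
  unfold gaussianWeight; fun_prop

theorem gaussianWeight_pos (t : ℝ) : 0 < gaussianWeight t := Real.exp_pos _

theorem summable_int_exp_neg_sq : Summable fun n : ℤ => Real.exp (2 - (n : ℝ) ^ 2) := by
  have h : Summable fun n : ℕ => Real.exp (2 - (n : ℝ) ^ 2) := by
    refine Summable.of_nonneg_of_le (fun _ => (Real.exp_pos _).le) (fun n => ?_)
      (Real.summable_exp_neg_nat.mul_left (Real.exp 2))
    rw [← Real.exp_add]
    apply Real.exp_le_exp.2
    have : (n : ℝ) ≤ (n : ℝ) ^ 2 := by exact_mod_cast Nat.le_self_pow two_ne_zero n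
    linarith
  refine Summable.of_nat_of_neg (by simpa using h) (by simpa using h)

theorem exists_eLpNorm_periodic_mul_gaussianWeight_le : ∃ K : ℝ≥0∞, K ≠ ⊤ ∧
    ∀ f : UnitAddCircle → ℂ, Measurable f →
      eLpNorm (fun t : ℝ => f t * gaussianWeight t) 2 volume ≤ K * eLpNorm f 2 haarAddCircle := by
  -- On `(n, n + 1]` one has `n² ≤ 2t² + 2`, so the squared Gaussian is at most `exp (2 - n²)`;
  -- these bounds are summed over the unit intervals.
  set a : ℤ → ℝ≥0∞ := fun n => ENNReal.ofReal (Real.exp (2 - (n : ℝ) ^ 2))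
  have ha : ∑' n, a n ≠ ⊤ := summable_int_exp_neg_sq.tsum_ofReal_ne_top
  refine ⟨(∑' n, a n) ^ (1 / 2 : ℝ), ENNReal.rpow_ne_top_of_nonneg (by norm_num) ha, fun f hf => ?_⟩
  rw [eLpNorm_eq_lintegral_rpow_enorm_toReal two_ne_zero ENNReal.ofNat_ne_top, eLpNorm_eq_lintegral_rpow_enorm_toReal two_ne_zero ENNReal.ofNat_ne_top]
  simp only [ENNReal.toReal_ofNat]
  rw [← ENNReal.mul_rpow_of_nonneg _ _ (by norm_num)]
  gcongr
  have hcov : ⋃ n : ℤ, Set.Ioc (n : ℝ) (n + 1) = Set.univ := iUnion_Ioc_intCast ℝ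
  rw [← setLIntegral_univ, ← hcov, ← ENNReal.tsum_mul_right]
  refine (lintegral_iUnion_le _ _).trans (ENNReal.tsum_le_tsum fun n => ?_)
  rw [← volume_eq_haarAddCircle, ← UnitAddCircle.lintegral_preimage n]
  rw [← lintegral_const_mul' _ _ ENNReal.ofReal_ne_top]
  refine setLIntegral_mono' measurableSet_Ioc fun t ht => ?_
  rw [enorm_mul, ENNReal.mul_rpow_of_nonneg _ _ (by norm_num), mul_comm]
  gcongr
  rw [← ofReal_norm, ENNReal.ofReal_rpow_of_nonneg (norm_nonneg _) (by norm_num)]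
  apply ENNReal.ofReal_le_ofReal
  rw [Complex.norm_real, Real.norm_of_nonneg (gaussianWeight_pos t).le, gaussianWeight]
  rw [Real.rpow_ofNat, ← Real.exp_nat_mul]
  apply Real.exp_le_exp.2
  obtain ⟨h1, h2⟩ := ht
  push_cast
  nlinarith [sq_nonneg (t + (t - n))]

theorem eLpNorm_gaussianWeight_ne_top : eLpNorm gaussianWeight 2 volume ≠ ⊤ := by
  obtain ⟨K, hK, h⟩ := exists_eLpNorm_periodic_mul_gaussianWeight_le
  have := h 1 measurable_one
  rw [show eLpNorm gaussianWeight 2 volume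
    = eLpNorm (fun t : ℝ => (1 : UnitAddCircle → ℂ) t * gaussianWeight t) 2 volume from
      eLpNorm_congr_norm_ae (ae_of_all _ fun t => by simp)]
  refine ne_top_of_le_ne_top ?_ this
  exact ENNReal.mul_ne_top hK (memLp_const (1 : ℂ)).2.ne

/-- Positive measurable weights dominated by the Gaussian. -/
def GoodWeight (G : ℝ → ℝ) : Prop := Measurable G ∧ ∀ t, 0 < G t ∧ G t ≤ gaussianWeight t

/-- The norm of `f` in `L²(G² dt)`. -/
noncomputable def wNorm (G : ℝ → ℝ) (f : ℝ → ℂ) : ℝ≥0∞ := eLpNorm (fun t => f t * G t) 2 volume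

/-- Continuous functions of norm at most `C` in `L²(G² dt)`. -/
def wBall (G : ℝ → ℝ) (C : ℝ≥0∞) : Set (ℝ → ℂ) := {f | Continuous f ∧ wNorm G f ≤ C}

theorem wNorm_mono {G G' : ℝ → ℝ} {f f' : ℝ → ℂ} (hG : ∀ t, 0 ≤ G t ∧ G t ≤ G' t)
    (hf : ∀ t, ‖f t‖ ≤ ‖f' t‖) : wNorm G f ≤ wNorm G' f' := by
  refine eLpNorm_mono fun t => ?_
  rw [norm_mul, norm_mul, Complex.norm_real, Complex.norm_real, Real.norm_of_nonneg (hG t).1,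
    Real.norm_of_nonneg ((hG t).1.trans (hG t).2)]
  exact mul_le_mul (hf t) (hG t).2 (hG t).1 (norm_nonneg _)

theorem wNorm_add_le {G : ℝ → ℝ} (hG : Measurable G) {f g : ℝ → ℂ} (hf : Continuous f)
    (hg : Continuous g) : wNorm G (f + g) ≤ wNorm G f + wNorm G g := by
  unfold wNorm
  refine le_trans (le_of_eq ?_) (eLpNorm_add_le (f := fun t => f t * G t) (g := fun t => g t * G t)
    ?_ ?_ (by norm_num))
  · congr 1; ext t; simp [add_mul]
  · exact (hf.measurable.mul (Complex.measurable_ofReal.comp hG)).aestronglyMeasurable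
  · exact (hg.measurable.mul (Complex.measurable_ofReal.comp hG)).aestronglyMeasurable

theorem wNorm_smul (G : ℝ → ℝ) (a : ℂ) (f : ℝ → ℂ) : wNorm G (a • f) = ‖a‖ₑ * wNorm G f := by
  unfold wNorm
  rw [← eLpNorm_const_smul]
  congr 1; ext t; simp [mul_assoc]

theorem wBall_mono {G G' : ℝ → ℝ} {C C' : ℝ≥0∞} (hG : ∀ t, 0 ≤ G' t ∧ G' t ≤ G t) (hC : C ≤ C') :
    wBall G C ⊆ wBall G' C' := fun _ hf =>
  ⟨hf.1, (wNorm_mono hG fun _ => le_rfl).trans (hf.2.trans hC)⟩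

/-- The weight obtained from `G` by multiplying it by `τ` on the preimage of `B`. -/
noncomputable def dampedWeight (B : Set UnitAddCircle) (τ : ℝ) (G : ℝ → ℝ) (t : ℝ) : ℝ :=
  B.indicator (fun _ => τ) (t : UnitAddCircle) * G t + Bᶜ.indicator (fun _ => 1) (t : UnitAddCircle) * G t

section
variable {B : Set UnitAddCircle} {τ : ℝ} {G : ℝ → ℝ}

theorem dampedWeight_of_mem {t : ℝ} (h : (t : UnitAddCircle) ∈ B) : dampedWeight B τ G t = τ * G t := by
  simp [dampedWeight, h]

theorem dampedWeight_of_notMem {t : ℝ} (h : (t : UnitAddCircle) ∉ B) : dampedWeight B τ G t = G t := by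
  simp [dampedWeight, h]

theorem dampedWeight_le (hG : GoodWeight G) (hτ1 : τ ≤ 1) (t : ℝ) : dampedWeight B τ G t ≤ G t := by
  by_cases h : (t : UnitAddCircle) ∈ B
  · rw [dampedWeight_of_mem h]; nlinarith [(hG.2 t).1]
  · rw [dampedWeight_of_notMem h]

theorem dampedWeight_pos (hG : GoodWeight G) (hτ : 0 < τ) (t : ℝ) : 0 < dampedWeight B τ G t := by
  by_cases h : (t : UnitAddCircle) ∈ B
  · rw [dampedWeight_of_mem h]; exact mul_pos hτ (hG.2 t).1
  · rw [dampedWeight_of_notMem h]; exact (hG.2 t).1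

theorem GoodWeight.damped (hG : GoodWeight G) (hB : MeasurableSet B) (hτ : 0 < τ) (hτ1 : τ ≤ 1) :
    GoodWeight (dampedWeight B τ G) := by
  refine ⟨?_, fun t => ⟨dampedWeight_pos hG hτ t, (dampedWeight_le hG hτ1 t).trans (hG.2 t).2⟩⟩
  have h1 : Measurable fun t : ℝ => B.indicator (fun _ => τ) (t : UnitAddCircle) :=
    (measurable_const.indicator hB).comp AddCircle.measurable_mk'
  have h2 : Measurable fun t : ℝ => Bᶜ.indicator (fun _ => (1 : ℝ)) (t : UnitAddCircle) :=
    (measurable_const.indicator hB.compl).comp AddCircle.measurable_mk'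
  exact (h1.mul hG.1).add (h2.mul hG.1)

end

/-- Off `B` the periodic estimate applies; over `B`, where `y` is merely bounded by `Y`, the factor
`τ` compensates. Complete removal, `τ = 0`, is the worst case for the distance between weights, but
a positive `τ` is used later to keep the weight positive. -/
theorem exists_wNorm_damped_le : ∃ K : ℝ≥0∞, K ≠ ⊤ ∧ ∀ (B : Set UnitAddCircle) (G : ℝ → ℝ),
    MeasurableSet B → GoodWeight G →
    eLpNorm (fun t => G t - dampedWeight B 0 G t) 2 volume ≤ K * haarAddCircle B ^ (1 / 2 : ℝ) ∧
    ∀ (y : UnitAddCircle → ℂ) (f : ℝ → ℂ) (Y τ : ℝ), Continuous y → 0 ≤ τ → τ ≤ 1 →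
      (∀ t, ‖y t‖ ≤ Y) → (∀ t : ℝ, ‖f t‖ = ‖y t‖) → Continuous f →
      wNorm (dampedWeight B τ G) f
        ≤ K * eLpNorm y 2 (haarAddCircle.restrict Bᶜ) + ENNReal.ofReal (τ * Y) * K := by
  obtain ⟨K, hK, hKb⟩ := exists_eLpNorm_periodic_mul_gaussianWeight_le
  refine ⟨K + eLpNorm gaussianWeight 2 volume, ENNReal.add_ne_top.2 ⟨hK, eLpNorm_gaussianWeight_ne_top⟩,
    fun B G hB hG => ⟨?_, fun y f Y τ hy hτ hτ1 hyY hfy hf => ?_⟩⟩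
  · calc eLpNorm (fun t => G t - dampedWeight B 0 G t) 2 volume
        ≤ eLpNorm (fun t : ℝ => B.indicator (1 : UnitAddCircle → ℂ) t * gaussianWeight t) 2 volume := by
          refine eLpNorm_mono fun t => ?_
          by_cases h : (t : UnitAddCircle) ∈ B
          · rw [dampedWeight_of_mem h, Set.indicator_of_mem h, Pi.one_apply, one_mul, zero_mul, sub_zero,
              Complex.norm_real, Real.norm_of_nonneg (hG.2 t).1.le,
              Real.norm_of_nonneg (gaussianWeight_pos t).le]
            exact (hG.2 t).2
          · rw [dampedWeight_of_notMem h, sub_self, norm_zero]; positivity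
      _ ≤ K * eLpNorm (B.indicator (1 : UnitAddCircle → ℂ)) 2 haarAddCircle :=
          hKb _ (measurable_one.indicator hB)
      _ ≤ K * haarAddCircle B ^ (1 / 2 : ℝ) := by
          gcongr
          have := eLpNorm_indicator_const_le (μ := haarAddCircle (T := 1)) (s := B) (1 : ℂ) 2
          rw [enorm_one, one_mul] at this
          exact this
      _ ≤ _ := by gcongr; exact le_self_add
  · set F₁ : ℝ → ℂ := fun t => Bᶜ.indicator y (t : UnitAddCircle) * gaussianWeight t with hF₁
    have hF₁m : Measurable F₁ :=
      ((hy.measurable.indicator hB.compl).comp AddCircle.measurable_mk').mul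
        (Complex.measurable_ofReal.comp continuous_gaussianWeight.measurable)
    have hY : 0 ≤ Y := (norm_nonneg _).trans (hyY 0)
    have hle : wNorm (dampedWeight B τ G) f ≤ eLpNorm ((fun t => ‖F₁ t‖) + (τ * Y) • gaussianWeight) 2 volume := by
      refine eLpNorm_mono fun t => ?_
      have hg := gaussianWeight_pos t
      rw [norm_mul, hfy, Complex.norm_real, Real.norm_of_nonneg, Real.norm_of_nonneg]
      · simp only [Pi.add_apply, Pi.smul_apply, smul_eq_mul]
        by_cases h : (t : UnitAddCircle) ∈ B
        · rw [dampedWeight_of_mem h]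
          have h1 : ‖y t‖ * (τ * G t) ≤ Y * (τ * gaussianWeight t) := by
            exact mul_le_mul (hyY _) (mul_le_mul_of_nonneg_left (hG.2 t).2 hτ)
              (mul_nonneg hτ (hG.2 t).1.le) hY
          have h2 := norm_nonneg (F₁ t)
          linarith
        · rw [dampedWeight_of_notMem h]
          have h1 : ‖F₁ t‖ = ‖y t‖ * gaussianWeight t := by
            rw [hF₁]; dsimp only
            rw [Set.indicator_of_mem (show (t : UnitAddCircle) ∈ Bᶜ from h), norm_mul, Complex.norm_real,
              Real.norm_of_nonneg hg.le]
          have h2 : ‖y t‖ * G t ≤ ‖y t‖ * gaussianWeight t := by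
            gcongr; exact (hG.2 t).2
          have h3 : 0 ≤ τ * Y * gaussianWeight t := by positivity
          linarith
      · simp only [Pi.add_apply, Pi.smul_apply, smul_eq_mul]; positivity
      · by_cases h : (t : UnitAddCircle) ∈ B
        · rw [dampedWeight_of_mem h]; exact mul_nonneg hτ (hG.2 t).1.le
        · rw [dampedWeight_of_notMem h]; exact (hG.2 t).1.le
    refine hle.trans ((eLpNorm_add_le hF₁m.norm.aestronglyMeasurable
      (continuous_gaussianWeight.const_smul _).aestronglyMeasurable (by norm_num)).trans ?_)
    refine add_le_add ?_ ?_
    · rw [eLpNorm_norm]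
      refine (hKb _ (hy.measurable.indicator hB.compl)).trans ?_
      rw [eLpNorm_indicator_eq_eLpNorm_restrict hB.compl]
      gcongr; exact le_self_add
    · rw [eLpNorm_const_smul, ← ofReal_norm, Real.norm_of_nonneg (by positivity)]
      gcongr; exact le_add_self

theorem dist_dampedWeight_le {B : Set UnitAddCircle} {τ : ℝ} {G : ℝ → ℝ} (hG : GoodWeight G) (hτ : 0 ≤ τ)
    (hτ1 : τ ≤ 1) : eLpNorm (fun t => G t - dampedWeight B τ G t) 2 volume
      ≤ eLpNorm (fun t => G t - dampedWeight B 0 G t) 2 volume := by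
  refine eLpNorm_mono fun t => ?_
  by_cases h : (t : UnitAddCircle) ∈ B
  · rw [dampedWeight_of_mem h, dampedWeight_of_mem h, Real.norm_of_nonneg, Real.norm_of_nonneg]
    · nlinarith [(hG.2 t).1]
    · nlinarith [(hG.2 t).1]
    · nlinarith [(hG.2 t).1]
  · rw [dampedWeight_of_notMem h, dampedWeight_of_notMem h]

theorem exists_pos_ofReal_mul_le {K ε : ℝ≥0∞} (hK : K ≠ ⊤) (hε : ε ≠ 0) :
    ∃ e : ℝ, 0 < e ∧ ENNReal.ofReal e * K ≤ ε := by
  obtain ⟨r, hr0, hr⟩ := ENNReal.exists_nnreal_pos_mul_lt hK hε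
  exact ⟨r, hr0, by rw [ENNReal.ofReal_coe_nnreal]; exact hr.le⟩

/-- There is a constant `C` such that every exponential `expo a` is approximated, after a small
decrease of the weight, by blocks of frequencies whose partial sums have norm at most `C`. -/
theorem exists_block_expo : ∃ C : ℝ≥0∞, C ≠ ⊤ ∧ ∀ (a η : ℝ) (G : ℝ → ℝ) (ε : ℝ≥0∞) (N : ℕ), 0 < a → a < η →
    GoodWeight G → ε ≠ 0 → ∃ G' N' Q, GoodWeight G' ∧ (∀ t, G' t ≤ G t) ∧
      eLpNorm (fun t => G t - G' t) 2 volume ≤ ε ∧ wNorm G' (Q - expo a) ≤ ε ∧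
      BlockSum (lineAtom η) N N' (wBall G' C) Q := by
  obtain ⟨K, hK, hKb⟩ := exists_wNorm_damped_le
  refine ⟨K * 4 + 1, ENNReal.add_ne_top.2 ⟨ENNReal.mul_ne_top hK ENNReal.ofNat_ne_top, ENNReal.one_ne_top⟩,
    fun a η G ε N ha haη hG hε => ?_⟩
  have hε1 : min (ε / 2) 1 ≠ 0 := by
    rw [← pos_iff_ne_zero]; exact lt_min (ENNReal.half_pos hε) one_pos
  obtain ⟨e, he, heK⟩ := exists_pos_ofReal_mul_le hK hε1
  -- The part `e` controls the error off `B`; the part `e²` makes the square root of the measure of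
  -- `B` at most `e`.
  set e' := min e (e ^ 2)
  have he' : 0 < e' := lt_min he (by positivity)
  obtain ⟨N', x, B, hB, hBm, hx1, hblk⟩ := exists_circle_block he' N
  obtain ⟨X, hblk⟩ := (hblk.inter _ circleAtom_subset_continuous).exists_bound (fun k f hf => by
    obtain ⟨c, rfl⟩ := hf
    refine ⟨‖c‖, fun t => ?_⟩
    rw [norm_mul, ← coe_nnnorm (fourier _ t), nnnorm_fourier_apply]; simp)
  have hX : 0 ≤ X := (norm_nonneg _).trans (hblk.mem.2 0)
  have hxc : Continuous x := hblk.mem.1.2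
  -- `X` bounds all partial sums of the block in sup norm, and `X + 1` also bounds `x - 1`.
  set τ := min 1 (e / (X + 1))
  have hτ : 0 < τ := lt_min one_pos (by positivity)
  have hτX : ENNReal.ofReal (τ * (X + 1)) * K ≤ min (ε / 2) 1 := by
    refine le_trans ?_ heK
    gcongr
    rw [← le_div_iff₀ (by positivity)]; exact min_le_right _ _
  obtain ⟨hK1, hK2⟩ := hKb B G hB hG
  refine ⟨dampedWeight B τ G, N', fun t => expo a t * x t, hG.damped hB hτ (min_le_left _ _),
    dampedWeight_le hG (min_le_left _ _), ?_, ?_, ?_⟩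
  · refine ((dist_dampedWeight_le hG hτ.le (min_le_left _ _)).trans hK1).trans ?_
    calc K * haarAddCircle B ^ (1 / 2 : ℝ) ≤ K * (ENNReal.ofReal e) := by
          gcongr
          calc haarAddCircle B ^ (1 / 2 : ℝ) ≤ (ENNReal.ofReal (e ^ 2)) ^ (1 / 2 : ℝ) := by
                gcongr
                exact hBm.trans (ENNReal.ofReal_le_ofReal (min_le_right _ _))
            _ = ENNReal.ofReal e := by
                rw [ENNReal.ofReal_rpow_of_nonneg (by positivity) (by norm_num), ← Real.sqrt_eq_rpow,
                  Real.sqrt_sq he.le]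
      _ ≤ ε := by rw [mul_comm]; exact heK.trans ((min_le_left _ _).trans ENNReal.half_le_self)
  · refine (hK2 (x - 1) _ (X + 1) τ (hxc.sub continuous_const) hτ.le (min_le_left _ _) (fun t => ?_) (fun t => ?_)
      ?_).trans ?_
    · refine (norm_sub_le _ _).trans ?_
      simpa using hblk.mem.2 t
    · rw [Pi.sub_apply, Pi.sub_apply, Pi.one_apply,
        show expo a t * x t - expo a t = expo a t * (x t - 1) by ring, norm_mul, norm_expo, one_mul]
    · exact ((continuous_expo a).mul (hxc.comp (AddCircle.continuous_mk' 1))).sub (continuous_expo a)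
    · calc _ ≤ ε / 2 + ε / 2 := by
            refine add_le_add ?_ (hτX.trans (min_le_left _ _))
            refine le_trans ?_ (heK.trans (min_le_left _ _))
            rw [mul_comm]
            gcongr
            exact hx1.trans (ENNReal.ofReal_le_ofReal (min_le_left _ _))
        _ = ε := ENNReal.add_halves ε
  · refine hblk.map (f := ⟨⟨fun g t => expo a t * g t, by ext; simp⟩, fun f g => by ext; simp [mul_add]⟩)
      (fun k z hz => ?_) fun z hz => ?_
    · obtain ⟨c, rfl⟩ := hz
      refine ⟨c, a, ha, haη, ?_⟩
      ext t
      have := fourier_coe_eq_expo ((k : ℤ) + 1) t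
      push_cast at this
      simp only [AddMonoidHom.coe_mk, ZeroHom.coe_mk]
      rw [this, expo_add ((k : ℝ) + 1)]; ring
    · have hzc : Continuous z := hz.1.2
      have hc : Continuous fun t : ℝ => expo a t * z t :=
        (continuous_expo a).mul (hzc.comp (AddCircle.continuous_mk' 1))
      refine ⟨hc, (hK2 z _ (X + 1) τ hzc hτ.le (min_le_left _ _) (fun t => (hz.2 t).trans (by linarith)) (fun t => ?_)
        hc).trans (add_le_add ?_ (hτX.trans (min_le_right _ _)))⟩
      · simp [norm_expo]
      · gcongr; exact hz.1.1.2

/-! ### Approximation under decreasing weights -/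

/-- The weight `G'` is a good weight below `G`, at distance at most `ε` in `L²`. -/
def WeightLE (G' G : ℝ → ℝ) (ε : ℝ≥0∞) : Prop :=
  GoodWeight G' ∧ (∀ t, G' t ≤ G t) ∧ eLpNorm (fun t => G t - G' t) 2 volume ≤ ε

theorem WeightLE.nonneg_and_le {G G' : ℝ → ℝ} {ε : ℝ≥0∞} (h : WeightLE G' G ε) (t : ℝ) :
    0 ≤ G' t ∧ G' t ≤ G t := ⟨(h.1.2 t).1.le, h.2.1 t⟩

theorem WeightLE.trans {G₁ G₂ G₃ : ℝ → ℝ} {a b : ℝ≥0∞} (h : WeightLE G₂ G₁ a) (h' : WeightLE G₃ G₂ b)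
    (hG : GoodWeight G₁) : WeightLE G₃ G₁ (a + b) := by
  refine ⟨h'.1, fun t => (h'.2.1 t).trans (h.2.1 t), ?_⟩
  have e : (fun t => G₁ t - G₃ t) = (fun t => G₁ t - G₂ t) + fun t => G₂ t - G₃ t := by
    ext t; simp
  rw [e]
  exact (eLpNorm_add_le (hG.1.sub h.1.1).aestronglyMeasurable (h.1.1.sub h'.1.1).aestronglyMeasurable
    (by norm_num)).trans (add_le_add h.2.2 h'.2.2)

/-- After an arbitrarily small decrease of any weight below `G`, the function `h` is arbitrarily well
approximated by blocks with arbitrarily high frequencies, whose partial sums have norm at most `C`. -/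
def Approximable (η : ℝ) (G : ℝ → ℝ) (h : ℝ → ℂ) (C : ℝ≥0∞) : Prop :=
  Continuous h ∧ ∀ G₁, GoodWeight G₁ → (∀ t, G₁ t ≤ G t) → ∀ ε : ℝ≥0∞, ε ≠ 0 → ∀ N, ∃ G₂ N' Q,
    WeightLE G₂ G₁ ε ∧ wNorm G₂ (Q - h) ≤ ε ∧ BlockSum (lineAtom η) N N' (wBall G₂ C) Q

theorem enorm_natCast_complex (n : ℕ) : ‖(n : ℂ)‖ₑ = n := by
  rw [← ofReal_norm, Complex.norm_natCast, ENNReal.ofReal_natCast]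

namespace Approximable

variable {η : ℝ} {G : ℝ → ℝ} {h h₁ h₂ : ℝ → ℂ} {C C₁ C₂ W κ : ℝ≥0∞}

theorem zero (hη : 0 < η) : Approximable η G 0 C := by
  refine ⟨continuous_const, fun G₁ hG₁ _ ε _ N => ⟨G₁, N, 0, ⟨hG₁, fun _ => le_rfl, by simp⟩, by simp [wNorm],
    (BlockSum.zero (zero_mem_lineAtom hη) le_rfl).mono ?_⟩⟩
  rintro _ rfl
  exact ⟨continuous_const, by simp [wNorm]⟩

theorem smul (hh : Approximable η G h C) (a : ℂ) : Approximable η G (a • h) (‖a‖ₑ * C) := by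
  refine ⟨hh.1.const_smul a, fun G₁ hG₁ hle ε hε N => ?_⟩
  have ha : ‖a‖ₑ + 1 ≠ ⊤ := ENNReal.add_ne_top.2 ⟨enorm_ne_top, ENNReal.one_ne_top⟩
  obtain ⟨G₂, N', Q, hG₂, hQ, hb⟩ := hh.2 G₁ hG₁ hle (min ε (ε / (‖a‖ₑ + 1))) (by
    rw [← pos_iff_ne_zero, lt_min_iff, pos_iff_ne_zero, pos_iff_ne_zero]
    exact ⟨hε, ENNReal.div_ne_zero.2 ⟨hε, ha⟩⟩) N
  refine ⟨G₂, N', a • Q, ⟨hG₂.1, hG₂.2.1, hG₂.2.2.trans (min_le_left _ _)⟩, ?_, ?_⟩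
  · rw [← smul_sub, wNorm_smul]
    calc _ ≤ (‖a‖ₑ + 1) * (ε / (‖a‖ₑ + 1)) :=
          mul_le_mul' le_self_add (hQ.trans (min_le_right _ _))
      _ ≤ ε := ENNReal.mul_div_le
  · refine hb.map (DistribSMul.toAddMonoidHom (ℝ → ℂ) a) (fun k z hz => ?_) fun z hz => ?_
    · obtain ⟨c, b, hb0, hb1, rfl⟩ := hz
      exact ⟨a * c, b, hb0, hb1, by ext t; simp [mul_assoc]⟩
    · refine ⟨hz.1.const_smul a, ?_⟩
      change wNorm G₂ (a • z) ≤ _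
      rw [wNorm_smul]
      gcongr; exact hz.2

theorem mono (hh : Approximable η G h C) (hC : C ≤ C₁) : Approximable η G h C₁ := by
  refine ⟨hh.1, fun G₁ hG₁ hle ε hε N => ?_⟩
  obtain ⟨G₂, N', Q, hG₂, hQ, hb⟩ := hh.2 G₁ hG₁ hle ε hε N
  exact ⟨G₂, N', Q, hG₂, hQ, hb.mono (wBall_mono (fun t => ⟨(hG₂.1.2 t).1.le, le_rfl⟩) hC)⟩

/-- The second block is built for the weight already decreased by the first, which is why
`Approximable` quantifies over all good weights below `G`. While it runs, the finished first block
contributes at most `W + κ`. -/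
theorem add (hh₁ : Approximable η G h₁ C₁) (hh₂ : Approximable η G h₂ C₂)
    (hW : wNorm G h₁ ≤ W) (hκ : κ ≠ 0) (hC₁ : C₁ ≤ C) (hC : W + κ + C₂ ≤ C) :
    Approximable η G (h₁ + h₂) C := by
  refine ⟨hh₁.1.add hh₂.1, fun G₁ hG₁ hle ε hε N => ?_⟩
  have hε' : min (ε / 2) κ ≠ 0 := by
    rw [← pos_iff_ne_zero]; exact lt_min (ENNReal.half_pos hε) (pos_iff_ne_zero.2 hκ)
  obtain ⟨G₂, N₁, Q₁, hG₂, hQ₁, hb₁⟩ := hh₁.2 G₁ hG₁ hle _ hε' N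
  obtain ⟨G₃, N₂, Q₂, hG₃, hQ₂, hb₂⟩ := hh₂.2 G₂ hG₂.1 (fun t => (hG₂.2.1 t).trans (hle t)) _ hε' N₁
  have hm := hG₃.nonneg_and_le
  have hQ₁' : wNorm G₃ (Q₁ - h₁) ≤ min (ε / 2) κ := (wNorm_mono hm fun _ => le_rfl).trans hQ₁
  have hc₁ := hb₁.mem.1
  have hc₂ := hb₂.mem.1
  refine ⟨G₃, N₂, Q₁ + Q₂, ?_, ?_, hb₁.concat hb₂ (wBall_mono hm hC₁) fun z hz => ⟨hc₁.add hz.1, ?_⟩⟩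
  · obtain ⟨a, b, c⟩ := hG₂.trans hG₃ hG₁
    exact ⟨a, b, c.trans ((add_le_add (min_le_left _ _) (min_le_left _ _)).trans (ENNReal.add_halves ε).le)⟩
  · rw [add_sub_add_comm]
    refine (wNorm_add_le hG₃.1.1 (hc₁.sub hh₁.1) (hc₂.sub hh₂.1)).trans ?_
    exact (add_le_add (hQ₁'.trans (min_le_left _ _)) (hQ₂.trans (min_le_left _ _))).trans (ENNReal.add_halves ε).le
  · refine (wNorm_add_le hG₃.1.1 hc₁ hz.1).trans (le_trans ?_ hC)
    refine add_le_add ?_ hz.2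
    rw [show Q₁ = h₁ + (Q₁ - h₁) by simp]
    refine (wNorm_add_le hG₃.1.1 hh₁.1 (hc₁.sub hh₁.1)).trans (add_le_add (le_trans ?_ hW) 
      (hQ₁'.trans (min_le_right _ _)))
    exact wNorm_mono (fun t => ⟨(hm t).1, (hm t).2.trans ((hG₂.2.1 t).trans (hle t))⟩) fun _ => le_rfl

/-- Only the copy in progress costs `C`; each finished copy costs about the norm of `h`. -/
theorem nsmul (hη : 0 < η) (hh : Approximable η G h C) (hκ : κ ≠ 0) (n : ℕ) :
    Approximable η G ((n : ℂ) • h) (n * wNorm G h + C + n * κ) := by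
  induction n with
  | zero => simpa using (zero hη)
  | succ n ih =>
    have := ih.add hh (W := n * wNorm G h) (by rw [wNorm_smul, enorm_natCast_complex]) hκ
      (C := ((n + 1 : ℕ) : ℝ≥0∞) * wNorm G h + C + ((n + 1 : ℕ) : ℝ≥0∞) * κ)
      (by gcongr <;> simp) (by
        push_cast
        calc n * wNorm G h + κ + C = n * wNorm G h + C + κ := by ring
          _ ≤ (n + 1) * wNorm G h + C + (n + 1) * κ := by
              gcongr
              · exact le_self_add
              · exact le_mul_of_one_le_left' le_add_self)
    convert this using 1
    push_cast
    rw [add_smul, one_smul]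

/-- Averaging many consecutive approximations of `h` makes the partial sums about as small as `h`. -/
theorem improve (hη : 0 < η) (hh : Approximable η G h C) (hCt : C ≠ ⊤) (hκ : κ ≠ 0) :
    Approximable η G h (wNorm G h + κ) := by
  -- After division by `n`, the cost `C` of the copy in progress is at most `κ / 2`.
  obtain ⟨n, hn⟩ := ENNReal.exists_nat_mul_gt (ENNReal.half_pos hκ).ne' hCt
  have hn0 : n ≠ 0 := by rintro rfl; simp at hn
  have h1 := (hh.nsmul hη (ENNReal.half_pos hκ).ne' n).smul ((n : ℂ)⁻¹)
  rw [smul_smul, inv_mul_cancel₀ (by exact_mod_cast hn0), one_smul] at h1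
  refine h1.mono ?_
  have e : ‖(n : ℂ)⁻¹‖ₑ = (n : ℝ≥0∞)⁻¹ := by
    rw [enorm_inv (by exact_mod_cast hn0), enorm_natCast_complex]
  have e1 : (n : ℝ≥0∞)⁻¹ * n = 1 := ENNReal.inv_mul_cancel (by exact_mod_cast hn0) (ENNReal.natCast_ne_top n)
  rw [e]
  calc (n : ℝ≥0∞)⁻¹ * (n * wNorm G h + C + n * (κ / 2))
      ≤ (n : ℝ≥0∞)⁻¹ * (n * wNorm G h + n * (κ / 2) + n * (κ / 2)) := by gcongr
    _ = ((n : ℝ≥0∞)⁻¹ * n) * (wNorm G h + (κ / 2 + κ / 2)) := by ring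
    _ = wNorm G h + κ := by rw [e1, one_mul, ENNReal.add_halves]

end Approximable

theorem wNorm_ne_top {G : ℝ → ℝ} (hG : GoodWeight G) {h : ℝ → ℂ} {B : ℝ} (hB : ∀ t, ‖h t‖ ≤ B) :
    wNorm G h ≠ ⊤ := by
  refine ne_top_of_le_ne_top (ENNReal.mul_ne_top (b := eLpNorm gaussianWeight 2 volume)
    (ENNReal.ofReal_ne_top (r := B)) eLpNorm_gaussianWeight_ne_top) ?_
  have hB0 : 0 ≤ B := (norm_nonneg _).trans (hB 0)
  refine eLpNorm_le_mul_eLpNorm_of_ae_le_mul (ae_of_all _ fun t => ?_) 2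
  rw [norm_mul, Complex.norm_real, Real.norm_of_nonneg (hG.2 t).1.le, Real.norm_of_nonneg (gaussianWeight_pos t).le]
  exact mul_le_mul (hB t) (hG.2 t).2 (hG.2 t).1.le hB0

theorem exists_bound_of_mem_span {η : ℝ} {h : ℝ → ℂ} (hh : h ∈ Submodule.span ℂ (expo '' Set.Ioo 0 η)) :
    ∃ B : ℝ, ∀ t, ‖h t‖ ≤ B := by
  induction hh using Submodule.span_induction with
  | mem x hx => obtain ⟨a, -, rfl⟩ := hx; exact ⟨1, fun t => (norm_expo a t).le⟩
  | zero => exact ⟨0, by simp⟩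
  | add x y _ _ hx hy =>
    obtain ⟨B, hB⟩ := hx
    obtain ⟨B', hB'⟩ := hy
    exact ⟨B + B', fun t => (norm_add_le _ _).trans (add_le_add (hB t) (hB' t))⟩
  | smul a x _ hx =>
    obtain ⟨B, hB⟩ := hx
    exact ⟨‖a‖ * B, fun t => by rw [Pi.smul_apply, norm_smul]; gcongr; exact hB t⟩

/-- Any finite `C`, depending on `h`, is good enough here, since `Approximable.improve` removes the
dependence afterwards. -/
theorem exists_approximable_of_mem_span {η : ℝ} (hη : 0 < η) {G : ℝ → ℝ} (hG : GoodWeight G) {h : ℝ → ℂ}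
    (hh : h ∈ Submodule.span ℂ (expo '' Set.Ioo 0 η)) : ∃ C : ℝ≥0∞, C ≠ ⊤ ∧ Approximable η G h C := by
  obtain ⟨C₀, hC₀, H⟩ := exists_block_expo
  induction hh using Submodule.span_induction with
  | mem x hx =>
    obtain ⟨a, ⟨ha0, ha1⟩, rfl⟩ := hx
    refine ⟨C₀, hC₀, continuous_expo a, fun G₁ hG₁ _ ε hε N => ?_⟩
    obtain ⟨G', N', Q, h1, h2, h3, h4, h5⟩ := H a η G₁ ε N ha0 ha1 hG₁ hε
    exact ⟨G', N', Q, ⟨h1, h2, h3⟩, h4, h5⟩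
  | zero => exact ⟨0, by simp, Approximable.zero hη⟩
  | add x y hxs _ hx hy =>
    obtain ⟨C, hC, hx⟩ := hx
    obtain ⟨C', hC', hy⟩ := hy
    obtain ⟨B, hB⟩ := exists_bound_of_mem_span hxs
    refine ⟨C + (wNorm G x + 1 + C'), ?_, hx.add hy le_rfl one_ne_zero le_self_add le_add_self⟩
    simp [hC, hC', wNorm_ne_top hG hB]
  | smul a x _ hx =>
    obtain ⟨C, hC, hx⟩ := hx
    exact ⟨_, ENNReal.mul_ne_top enorm_ne_top hC, hx.smul a⟩

/-! ### Density of exponentials with small frequencies -/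

/-- Every test function is the Fourier transform of a Schwartz function, so the multiplication
formula shows that `φ` annihilates all test functions. -/
theorem ae_eq_zero_of_fourier_eq_zero {φ : ℝ → ℂ} (hφ : Integrable φ) (h : ∀ ξ, 𝓕 φ ξ = 0) :
    φ =ᵐ[volume] 0 := by
  refine ae_eq_zero_of_integral_contDiff_smul_eq_zero hφ.locallyIntegrable fun g hg hgs => ?_
  have hgs' : HasCompactSupport fun x => (g x : ℂ) := hgs.comp_left (g := fun r : ℝ => (r : ℂ)) rfl
  set s : SchwartzMap ℝ ℂ := hgs'.toSchwartzMap (Complex.ofRealCLM.contDiff.comp hg) with hs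
  set r : SchwartzMap ℝ ℂ := 𝓕⁻ s
  have hr : 𝓕 (r : ℝ → ℂ) = s := by
    rw [← SchwartzMap.fourier_coe]; congr 1; exact FourierTransform.fourier_fourierInv_eq s
  have key := VectorFourier.integral_fourierIntegral_smul_eq_flip (μ := volume) (ν := volume) (L := innerₗ ℝ)
    Real.continuous_fourierChar continuous_inner hφ r.integrable
  have h1 : ∀ ξ, VectorFourier.fourierIntegral Real.fourierChar volume (innerₗ ℝ) φ ξ = 0 := h
  simp only [h1, zero_smul, integral_zero, flip_innerₗ] at key
  have h2 : ∀ x, VectorFourier.fourierIntegral Real.fourierChar volume (innerₗ ℝ) r x = g x := by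
    intro x
    change 𝓕 (r : ℝ → ℂ) x = _
    rw [hr]; rfl
  simp only [h2] at key
  rw [key]
  refine integral_congr_ae (ae_of_all _ fun x => ?_)
  simp [mul_comm]

theorem memLp_exp_neg_half_sq : MemLp (fun t : ℝ => Real.exp (-(1 / 2) * t ^ 2)) 2 volume := by
  rw [memLp_two_iff_integrable_sq (Continuous.aestronglyMeasurable (by fun_prop))]
  refine (integrable_exp_neg_mul_sq one_pos).congr (ae_of_all _ fun t => ?_)
  dsimp only
  rw [← Real.exp_nat_mul]; congr 1; push_cast; ring

/-- The Gaussian absorbs any exponential growth. The spare factor `exp |t|` in `hbound` dominates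
both `1` and the `|t|` produced by differentiating in `z`. -/
theorem differentiable_laplace {v φ : ℝ → ℂ} (hv : MemLp v 2 volume) (hφm : AEStronglyMeasurable φ volume)
    (hφ : ∀ t, ‖φ t‖ ≤ gaussianWeight t * ‖v t‖) :
    Differentiable ℂ fun z : ℂ => ∫ t : ℝ, Complex.exp (z * t) * φ t := by
  intro z₀
  set R : ℝ := ‖z₀‖ + 1
  have hb : Integrable fun t : ℝ => Real.exp ((R + 1) ^ 2 / 2) * (Real.exp (-(1 / 2) * t ^ 2) * ‖v t‖) :=
    (memLp_exp_neg_half_sq.integrable_mul hv.norm).const_mul _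
  have hbound : ∀ z ∈ Metric.ball z₀ 1, ∀ t : ℝ, Real.exp |t| * ‖Complex.exp (z * t) * φ t‖
      ≤ Real.exp ((R + 1) ^ 2 / 2) * (Real.exp (-(1 / 2) * t ^ 2) * ‖v t‖) := by
    intro z hz t
    have hzR : ‖z‖ ≤ R := by
      have : ‖z - z₀‖ < 1 := by simpa [dist_eq_norm] using hz
      calc ‖z‖ = ‖z₀ + (z - z₀)‖ := by simp
        _ ≤ ‖z₀‖ + ‖z - z₀‖ := norm_add_le _ _
        _ ≤ R := by simp only [R]; linarith
    have h1 : ‖Complex.exp (z * t)‖ ≤ Real.exp (R * |t|) := by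
      rw [Complex.norm_exp]
      apply Real.exp_le_exp.2
      calc (z * t).re ≤ ‖z * t‖ := Complex.re_le_norm _
        _ = ‖z‖ * |t| := by simp
        _ ≤ R * |t| := by gcongr
    calc Real.exp |t| * ‖Complex.exp (z * t) * φ t‖
        ≤ Real.exp |t| * (Real.exp (R * |t|) * (gaussianWeight t * ‖v t‖)) := by
          rw [norm_mul]; gcongr; exact hφ t
      _ = Real.exp (|t| + R * |t| - t ^ 2) * ‖v t‖ := by
          rw [gaussianWeight, ← mul_assoc, ← mul_assoc, ← Real.exp_add, ← Real.exp_add]; rfl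
      _ ≤ Real.exp ((R + 1) ^ 2 / 2 + -(1 / 2) * t ^ 2) * ‖v t‖ := by
          gcongr
          have := sq_abs t
          nlinarith [sq_nonneg (R + 1 - |t|)]
      _ = _ := by rw [Real.exp_add, mul_assoc]
  have hm : ∀ z : ℂ, AEStronglyMeasurable (fun t : ℝ => Complex.exp (z * t) * φ t) volume := fun z =>
    (Continuous.aestronglyMeasurable (by fun_prop)).mul hφm
  refine (hasDerivAt_integral_of_dominated_loc_of_deriv_le (Metric.ball_mem_nhds z₀ one_pos)
    (F' := fun z t => (t : ℂ) * (Complex.exp (z * t) * φ t))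
    (Eventually.of_forall hm) ?_ ((Continuous.aestronglyMeasurable (by fun_prop)).mul (hm z₀)) (ae_of_all _ fun t z hz => ?_) hb
    (ae_of_all _ fun t z _ => ?_)).2.differentiableAt
  · refine hb.mono' (hm z₀) (ae_of_all _ fun t => le_trans ?_ (hbound z₀ (Metric.mem_ball_self one_pos) t))
    exact le_mul_of_one_le_left (norm_nonneg _) (Real.one_le_exp (abs_nonneg t))
  · refine le_trans ?_ (hbound z hz t)
    rw [norm_mul, Complex.norm_real, Real.norm_eq_abs]
    gcongr
    linarith [Real.add_one_le_exp |t|]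
  · have h1 : HasDerivAt (fun z : ℂ => z * t) (t : ℂ) z := by
      simpa using (hasDerivAt_id z).mul_const (t : ℂ)
    exact (h1.cexp.mul_const (φ t)).congr_deriv (by ring)

theorem memLp_mul_weight {G : ℝ → ℝ} (hGm : Measurable G) (hG : ∀ t, |G t| ≤ gaussianWeight t) {f : ℝ → ℂ}
    (hf : Continuous f) {B : ℝ} (hB : ∀ t, ‖f t‖ ≤ B) : MemLp (fun t => f t * G t) 2 volume := by
  refine MemLp.of_le_mul (g := gaussianWeight) (c := B)
    ⟨continuous_gaussianWeight.aestronglyMeasurable, eLpNorm_gaussianWeight_ne_top.lt_top⟩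
    (hf.measurable.mul (Complex.measurable_ofReal.comp hGm)).aestronglyMeasurable (ae_of_all _ fun t => ?_)
  rw [norm_mul, Complex.norm_real, Real.norm_of_nonneg (gaussianWeight_pos t).le]
  exact mul_le_mul (hB t) (hG t) (norm_nonneg _) ((norm_nonneg _).trans (hB t))

theorem GoodWeight.abs_le {G : ℝ → ℝ} (hG : GoodWeight G) (t : ℝ) : |G t| ≤ gaussianWeight t := by
  rw [abs_of_pos (hG.2 t).1]; exact (hG.2 t).2

theorem expo_memLp {G : ℝ → ℝ} (hG : GoodWeight G) (a : ℝ) : MemLp (fun t => expo a t * G t) 2 volume :=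
  memLp_mul_weight hG.1 hG.abs_le (continuous_expo a) (fun t => (norm_expo a t).le)

/-- The Fourier transform of `G v` extends to an entire function; vanishing on an interval, it
vanishes on the whole line. So `G v = 0` almost everywhere, and strict positivity of `G` gives `v =
0`. -/
theorem ae_eq_zero_of_forall_integral_expo_eq_zero {G : ℝ → ℝ} (hG : GoodWeight G) {η : ℝ} (hη : 0 < η) {v : ℝ → ℂ}
    (hv : MemLp v 2 volume) (h : ∀ a ∈ Set.Ioo 0 η, ∫ t, (starRingEnd ℂ) (expo a t) * (G t * v t) = 0) :
    v =ᵐ[volume] 0 := by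
  set φ : ℝ → ℂ := fun t => G t * v t
  have hφm : AEStronglyMeasurable φ volume :=
    (Complex.measurable_ofReal.comp hG.1).aestronglyMeasurable.mul hv.1
  have hφle : ∀ t, ‖φ t‖ ≤ gaussianWeight t * ‖v t‖ := fun t => by
    rw [norm_mul, Complex.norm_real, Real.norm_of_nonneg (hG.2 t).1.le]
    gcongr; exact (hG.2 t).2
  have hΦ := (differentiable_laplace hv hφm hφle).comp
    (show Differentiable ℂ fun z : ℂ => -2 * Real.pi * Complex.I * z by fun_prop)
  set Φ : ℂ → ℂ := (fun z : ℂ => ∫ t : ℝ, Complex.exp (z * t) * φ t) ∘ fun z : ℂ => -2 * Real.pi * Complex.I * z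
  have hΦa : ∀ a ∈ Set.Ioo 0 η, Φ (a : ℝ) = 0 := fun a ha => by
    rw [← h a ha]
    refine integral_congr_ae (ae_of_all _ fun t => ?_)
    dsimp only
    congr 1
    rw [expo, ← Complex.exp_conj]
    congr 1
    simp [Complex.conj_ofReal, map_ofNat]
  have hz : Set.EqOn Φ 0 Set.univ := by
    refine AnalyticOnNhd.eqOn_zero_of_preconnected_of_frequently_eq_zero (z₀ := ((η / 2 : ℝ) : ℂ))
      (fun z _ => hΦ.analyticAt z) isPreconnected_univ (Set.mem_univ _) ?_
    have h1 : Tendsto (fun a : ℝ => (a : ℂ)) (𝓝[≠] (η / 2)) (𝓝[≠] ((η / 2 : ℝ) : ℂ)) := by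
      refine tendsto_nhdsWithin_of_tendsto_nhds_of_eventually_within _
        (Complex.continuous_ofReal.continuousAt.tendsto.mono_left nhdsWithin_le_nhds) ?_
      filter_upwards [self_mem_nhdsWithin] with a ha
      exact fun h' => ha (Complex.ofReal_injective h')
    refine h1.frequently (Eventually.frequently ?_)
    filter_upwards [nhdsWithin_le_nhds (Ioo_mem_nhds (show (0 : ℝ) < η / 2 by positivity) (by linarith : η / 2 < η))]
      with a ha
    exact hΦa a ha
  have hφi : Integrable φ := by
    have hg : MemLp gaussianWeight 2 volume :=
      ⟨continuous_gaussianWeight.aestronglyMeasurable, eLpNorm_gaussianWeight_ne_top.lt_top⟩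
    exact (hg.integrable_mul hv.norm).mono' hφm (ae_of_all _ hφle)
  have := ae_eq_zero_of_fourier_eq_zero hφi fun ξ => by
    rw [Real.fourier_eq']
    refine Eq.trans ?_ (hz (Set.mem_univ (ξ : ℂ)))
    refine integral_congr_ae (ae_of_all _ fun t => ?_)
    simp only [smul_eq_mul]
    congr 2
    simp; ring
  filter_upwards [this] with t ht
  exact (mul_eq_zero.1 ht).resolve_left (by exact_mod_cast (hG.2 t).1.ne')

theorem exists_mem_span_expo_near {G : ℝ → ℝ} (hG : GoodWeight G) {η : ℝ} (hη : 0 < η) {u : ℝ → ℂ}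
    (hu : MemLp u 2 volume) {ε : ℝ≥0∞} (hε : ε ≠ 0) : ∃ h ∈ Submodule.span ℂ (expo '' Set.Ioo 0 η),
      eLpNorm (fun t => h t * G t - u t) 2 volume ≤ ε := by
  set V : Submodule ℂ (Lp ℂ 2 (volume : Measure ℝ)) :=
    Submodule.span ℂ ((fun a => (expo_memLp hG a).toLp) '' Set.Ioo 0 η) with hV
  have hdense : V.topologicalClosure = ⊤ := by
    rw [Submodule.topologicalClosure_eq_top_iff, Submodule.eq_bot_iff]
    intro v hv
    have := ae_eq_zero_of_forall_integral_expo_eq_zero hG hη (Lp.memLp v) fun a ha => by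
      have h1 := (Submodule.mem_orthogonal _ _).1 hv _ (Submodule.subset_span ⟨a, ha, rfl⟩)
      rw [L2.inner_def] at h1
      rw [← h1]
      refine integral_congr_ae ?_
      filter_upwards [(expo_memLp hG a).coeFn_toLp] with t ht
      rw [ht]
      simp [Complex.conj_ofReal]
      ring
    exact (Lp.eq_zero_iff_ae_eq_zero).2 this
  have hrep : ∀ w ∈ V, ∃ h ∈ Submodule.span ℂ (expo '' Set.Ioo 0 η),
      (w : ℝ → ℂ) =ᵐ[volume] fun t => h t * G t := by
    intro w hw
    induction hw using Submodule.span_induction with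
    | mem x hx =>
      obtain ⟨a, ha, rfl⟩ := hx
      exact ⟨expo a, Submodule.subset_span ⟨a, ha, rfl⟩, (expo_memLp hG a).coeFn_toLp⟩
    | zero =>
      refine ⟨0, Submodule.zero_mem _, ?_⟩
      filter_upwards [Lp.coeFn_zero ℂ 2 (volume : Measure ℝ)] with t _
      simp
    | add x y _ _ hx hy =>
      obtain ⟨f, hf, hfx⟩ := hx
      obtain ⟨g, hg, hgy⟩ := hy
      refine ⟨f + g, Submodule.add_mem _ hf hg, ?_⟩
      filter_upwards [Lp.coeFn_add x y, hfx, hgy] with t h1 h2 h3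
      rw [h1, Pi.add_apply, h2, h3, Pi.add_apply, add_mul]
    | smul c x _ hx =>
      obtain ⟨f, hf, hfx⟩ := hx
      refine ⟨c • f, Submodule.smul_mem _ _ hf, ?_⟩
      filter_upwards [Lp.coeFn_smul c x, hfx] with t h1 h2
      rw [h1, Pi.smul_apply, h2, Pi.smul_apply, smul_eq_mul, smul_eq_mul, mul_assoc]
  have hmem : hu.toLp ∈ closure (V : Set (Lp ℂ 2 (volume : Measure ℝ))) := by
    rw [← Submodule.topologicalClosure_coe, hdense]; trivial
  obtain ⟨w, hw, hd⟩ := EMetric.mem_closure_iff.1 hmem ε (pos_iff_ne_zero.2 hε)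
  obtain ⟨h, hh, hwh⟩ := hrep w hw
  refine ⟨h, hh, ?_⟩
  rw [edist_comm, Lp.edist_def] at hd
  refine le_of_eq_of_le (eLpNorm_congr_ae ?_) hd.le
  filter_upwards [hwh, hu.coeFn_toLp] with t h1 h2
  rw [Pi.sub_apply, h1, h2]

/-! ### Construction of the weight and its blocks -/

theorem exists_stage {G : ℝ → ℝ} (hG : GoodWeight G) {u : ℝ → ℂ} (hu : MemLp u 2 volume) {η : ℝ} (hη : 0 < η)
    {ε : ℝ≥0∞} (hε : ε ≠ 0) (N : ℕ) : ∃ G' N' Q, WeightLE G' G ε ∧ N < N' ∧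
      eLpNorm (fun t => Q t * G' t - u t) 2 volume ≤ ε ∧ (∃ B : ℝ, ∀ t, ‖Q t‖ ≤ B) ∧
      BlockSum (lineAtom η) N N' (wBall G' (eLpNorm u 2 volume + 1)) Q := by
  -- Three errors are added: block against `h`, change of weight, `h` against `u`. The cap `1/2`,
  -- with `κ = 1/2` below, yields the `+ 1` in the bound on partial sums.
  set e := min (ε / 3) (1 / 2) with he
  have he0 : e ≠ 0 := by
    rw [← pos_iff_ne_zero, he]
    exact lt_min (ENNReal.div_pos hε (by simp)) (by simp)
  obtain ⟨h, hh, hhu⟩ := exists_mem_span_expo_near hG hη hu he0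
  obtain ⟨H, hH⟩ := exists_bound_of_mem_span hh
  have hH0 : 0 ≤ H := (norm_nonneg _).trans (hH 0)
  obtain ⟨C, hC, happ⟩ := exists_approximable_of_mem_span hη hG hh
  have happ' := happ.improve hη hC (κ := 1 / 2) (by simp)
  have hHt : ENNReal.ofReal H + 1 ≠ ⊤ := by simp
  have hGm := Complex.measurable_ofReal.comp hG.1
  obtain ⟨G', N', Q, hG', hQ, hb⟩ := happ'.2 G hG (fun _ => le_rfl) (min e (e / (ENNReal.ofReal H + 1))) (by
    rw [← pos_iff_ne_zero, lt_min_iff]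
    exact ⟨pos_iff_ne_zero.2 he0, ENNReal.div_pos he0 hHt⟩) N
  have hGm' := Complex.measurable_ofReal.comp hG'.1.1
  have hQc : Continuous Q := hb.mem.1
  obtain ⟨B, hB⟩ := hb.exists_bound (fun k f hf => by
    obtain ⟨c, a, -, -, rfl⟩ := hf
    exact ⟨‖c‖, fun t => by rw [norm_mul, norm_expo, mul_one]⟩)
  have heε : e ≤ ε := (min_le_left _ _).trans (ENNReal.div_le_of_le_mul (le_mul_of_one_le_right' (by norm_num)))
  -- One extra index makes the block nonempty, so that the endpoints will be strictly increasing.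
  refine ⟨G', N' + 1, Q, ⟨hG'.1, hG'.2.1, hG'.2.2.trans ((min_le_left _ _).trans heε)⟩, Nat.lt_succ_of_le hb.1, ?_,
    ⟨B, hB.mem.2⟩, (hb.mono (wBall_mono (fun t => ⟨(hG'.1.2 t).1.le, le_rfl⟩) ?_)).pad (zero_mem_lineAtom hη) (Nat.le_succ _)⟩
  · have e1 : (fun t => Q t * G' t - u t) = (fun t => (Q - h) t * G' t) + (fun t => h t * ((G' t : ℂ) - G t))
        + fun t => h t * G t - u t := by
      ext t; simp only [Pi.add_apply, Pi.sub_apply]; ring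
    have m1 : AEStronglyMeasurable (fun t => (Q - h) t * G' t) volume :=
      (((hQc.sub happ.1).measurable).mul hGm').aestronglyMeasurable
    have m2 : AEStronglyMeasurable (fun t => h t * ((G' t : ℂ) - G t)) volume :=
      (happ.1.measurable.mul (hGm'.sub hGm)).aestronglyMeasurable
    have m3 : AEStronglyMeasurable (fun t => h t * G t - u t) volume :=
      (happ.1.measurable.mul hGm).aestronglyMeasurable.sub hu.1
    rw [e1]
    refine (eLpNorm_add_le (m1.add m2) m3 (by norm_num)).trans ?_
    have b2 : eLpNorm (fun t => h t * ((G' t : ℂ) - G t)) 2 volume ≤ e := by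
      calc _ ≤ ENNReal.ofReal H * eLpNorm (fun t => G t - G' t) 2 volume := by
            refine eLpNorm_le_mul_eLpNorm_of_ae_le_mul (ae_of_all _ fun t => ?_) 2
            rw [norm_mul, ← Complex.ofReal_sub, Complex.norm_real, ← norm_neg (G t - G' t), neg_sub]
            gcongr; exact hH t
        _ ≤ (ENNReal.ofReal H + 1) * (e / (ENNReal.ofReal H + 1)) :=
            mul_le_mul' le_self_add (hG'.2.2.trans (min_le_right _ _))
        _ ≤ e := ENNReal.mul_div_le
    calc _ ≤ e + e + e := add_le_add ((eLpNorm_add_le m1 m2 (by norm_num)).trans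
            (add_le_add (hQ.trans (min_le_left _ _)) b2)) hhu
      _ ≤ ε / 3 + ε / 3 + ε / 3 := by gcongr <;> exact min_le_left _ _
      _ = ε := ENNReal.add_thirds ε
  · have : wNorm G h ≤ eLpNorm u 2 volume + 1 / 2 := by
      have e1 : (fun t => h t * (G t : ℂ)) = u + fun t => h t * G t - u t := by ext t; simp
      rw [wNorm, e1]
      refine (eLpNorm_add_le hu.1 ((happ.1.measurable.mul hGm).aestronglyMeasurable.sub hu.1) (by norm_num)).trans ?_
      gcongr
      exact hhu.trans (min_le_right _ _)
    calc wNorm G h + 1 / 2 ≤ eLpNorm u 2 volume + 1 / 2 + 1 / 2 := by gcongr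
      _ = _ := by rw [add_assoc, ENNReal.add_halves]

theorem exists_weight_sequence {u : ℕ → ℝ → ℂ} (hu : ∀ k, MemLp (u k) 2 volume) {η : ℕ → ℝ} (hη : ∀ k, 0 < η k)
    {ε₀ : ℝ≥0∞} (hε₀ : ε₀ ≠ 0) : ∃ (N : ℕ → ℕ) (G : ℕ → ℝ → ℝ) (ε : ℕ → ℝ≥0∞) (Q : ℕ → ℝ → ℂ) (B : ℕ → ℝ),
      N 0 = 0 ∧ ε 0 = ε₀ ∧ GoodWeight (G 0) ∧ ∀ k, N k < N (k + 1) ∧ WeightLE (G (k + 1)) (G k) (ε k) ∧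
        (∀ t, ‖Q k t‖ ≤ B k) ∧ ε (k + 1) ≤ ε k / 2 ∧ ENNReal.ofReal (B k) * (2 * ε (k + 1)) ≤ ε k ∧
        eLpNorm (fun t => Q k t * G (k + 1) t - u k t) 2 volume ≤ ε k ∧
        BlockSum (lineAtom (η k)) (N k) (N (k + 1)) (wBall (G (k + 1)) (eLpNorm (u k) 2 volume + 1)) (Q k) := by
  have step : ∀ (k : ℕ) (s : {s : ℕ × (ℝ → ℝ) × ℝ≥0∞ // GoodWeight s.2.1 ∧ s.2.2 ≠ 0}),
      ∃ (s' : {s : ℕ × (ℝ → ℝ) × ℝ≥0∞ // GoodWeight s.2.1 ∧ s.2.2 ≠ 0}) (Q : ℝ → ℂ) (B : ℝ),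
        s.1.1 < s'.1.1 ∧ WeightLE s'.1.2.1 s.1.2.1 s.1.2.2 ∧
        (∀ t, ‖Q t‖ ≤ B) ∧ s'.1.2.2 ≤ s.1.2.2 / 2 ∧ ENNReal.ofReal B * (2 * s'.1.2.2) ≤ s.1.2.2 ∧
        eLpNorm (fun t => Q t * s'.1.2.1 t - u k t) 2 volume ≤ s.1.2.2 ∧
        BlockSum (lineAtom (η k)) s.1.1 s'.1.1 (wBall s'.1.2.1 (eLpNorm (u k) 2 volume + 1)) Q := by
    rintro k ⟨⟨N, G, ε⟩, hG, hε⟩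
    obtain ⟨G', N', Q, h1, h2, h3, ⟨B, h4⟩, h5⟩ := exists_stage hG (hu k) (hη k) hε N
    -- The next tolerance is fixed after `Q` and its sup bound `B`. As tolerances at least halve,
    -- all later decreases of the weight total at most twice this one and move `Q G'` by at most
    -- `ε`.
    have hne : ε / 2 / (ENNReal.ofReal B + 1) ≠ 0 :=
      ENNReal.div_ne_zero.2 ⟨(ENNReal.half_pos hε).ne', by simp⟩
    refine ⟨⟨(N', G', ε / 2 / (ENNReal.ofReal B + 1)), h1.1, hne⟩, Q, B, h2, h1, h4, ?_, ?_, h3, h5⟩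
    · exact ENNReal.div_le_of_le_mul (le_mul_of_one_le_right' le_add_self)
    · calc ENNReal.ofReal B * (2 * (ε / 2 / (ENNReal.ofReal B + 1)))
          ≤ (ENNReal.ofReal B + 1) * (2 * (ε / 2 / (ENNReal.ofReal B + 1))) := by gcongr; exact le_self_add
        _ = 2 * ((ENNReal.ofReal B + 1) * (ε / 2 / (ENNReal.ofReal B + 1))) := by ring
        _ ≤ 2 * (ε / 2) := by gcongr; exact ENNReal.mul_div_le
        _ = ε := ENNReal.mul_div_cancel (by simp) (by simp)
  choose next Q B hnext using step
  have hg : GoodWeight gaussianWeight :=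
    ⟨continuous_gaussianWeight.measurable, fun t => ⟨gaussianWeight_pos t, le_rfl⟩⟩
  let s : ℕ → {s : ℕ × (ℝ → ℝ) × ℝ≥0∞ // GoodWeight s.2.1 ∧ s.2.2 ≠ 0} := fun n =>
    Nat.rec ⟨(0, gaussianWeight, ε₀), hg, hε₀⟩ (fun k s => next k s) n
  exact ⟨fun k => (s k).1.1, fun k => (s k).1.2.1, fun k => (s k).1.2.2, fun k => Q k (s k), fun k => B k (s k),
    rfl, rfl, hg, fun k => hnext k (s k)⟩

/-- The limit weight is the pointwise infimum. Lowering the weight preserves the bounds on partial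
sums, and the tolerances keep `Q k * G` near `u k`. Positivity of the limit is no longer needed:
density was used only at the finite stages. -/
theorem exists_weight_blocks {u : ℕ → ℝ → ℂ} (hu : ∀ k, MemLp (u k) 2 volume) {η : ℕ → ℝ} (hη : ∀ k, 0 < η k)
    {ε₀ : ℝ≥0∞} (hε₀ : ε₀ ≠ 0) : ∃ (G : ℝ → ℝ) (N : ℕ → ℕ) (Q : ℕ → ℝ → ℂ), Measurable G ∧
      (∀ t, |G t| ≤ gaussianWeight t) ∧ N 0 = 0 ∧ StrictMono N ∧ ∀ k,
        eLpNorm (fun t => Q k t * G t - u k t) 2 volume ≤ 2 * ε₀ * 2⁻¹ ^ k ∧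
        BlockSum (lineAtom (η k)) (N k) (N (k + 1)) (wBall G (eLpNorm (u k) 2 volume + 1)) (Q k) := by
  obtain ⟨N, G, ε, Q, B, hN0, hε0, hG0, H⟩ := exists_weight_sequence hu hη hε₀
  have hgood : ∀ k, GoodWeight (G k) := fun k => by
    cases k with
    | zero => exact hG0
    | succ k => exact (H k).2.1.1
  have hanti : ∀ t, Antitone fun k => G k t := fun t => antitone_nat_of_succ_le fun k => (H k).2.1.2.1 t
  set L : ℝ → ℝ := fun t => ⨅ k, G k t with hL
  have hbdd : ∀ t, BddBelow (Set.range fun k => G k t) := fun t =>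
    ⟨0, by rintro _ ⟨k, rfl⟩; exact ((hgood k).2 t).1.le⟩
  have hlim : ∀ t, Tendsto (fun k => G k t) atTop (𝓝 (L t)) := fun t => tendsto_atTop_ciInf (hanti t) (hbdd t)
  have hLle : ∀ k t, 0 ≤ L t ∧ L t ≤ G k t := fun k t =>
    ⟨le_ciInf fun k => ((hgood k).2 t).1.le, ciInf_le (hbdd t) k⟩
  have hLm : Measurable L := Measurable.iInf fun k => (hgood k).1
  have hdist : ∀ n k, eLpNorm (fun t => G k t - G (k + n) t) 2 volume ≤ 2 * ε k := by
    intro n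
    induction n with
    | zero => intro k; simp
    | succ n ih =>
      intro k
      have e1 : (fun t => G k t - G (k + (n + 1)) t)
          = (fun t => G k t - G (k + 1) t) + fun t => G (k + 1) t - G (k + 1 + n) t := by
        ext t; simp [add_assoc, add_comm 1 n]
      rw [e1]
      refine (eLpNorm_add_le ((hgood _).1.sub (hgood _).1).aestronglyMeasurable
        ((hgood _).1.sub (hgood _).1).aestronglyMeasurable (by norm_num)).trans ?_
      calc _ ≤ ε k + 2 * (ε k / 2) := add_le_add (H k).2.1.2.2
            ((ih (k + 1)).trans (by gcongr; exact (H k).2.2.2.1))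
        _ = 2 * ε k := by rw [ENNReal.mul_div_cancel (by simp) (by simp), two_mul]
  have hdistL : ∀ k, eLpNorm (fun t => G k t - L t) 2 volume ≤ 2 * ε k := fun k => by
    -- Fatou's lemma carries the bound on finite differences over to the limit weight.
    refine (Lp.eLpNorm_lim_le_liminf_eLpNorm (f := fun n t => G k t - G (k + n) t)
      (fun n => ((hgood _).1.sub (hgood _).1).aestronglyMeasurable) _ (ae_of_all _ fun t => ?_)).trans ?_
    · refine tendsto_const_nhds.sub ?_
      have := (tendsto_add_atTop_iff_nat k).2 (hlim t)
      simpa only [add_comm] using this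
    · exact (liminf_le_liminf (Eventually.of_forall fun n => hdist n k)).trans (by simp)
  have hεk : ∀ k, ε k ≤ ε₀ * 2⁻¹ ^ k := by
    intro k
    induction k with
    | zero => simp [hε0]
    | succ k ih =>
      refine (H k).2.2.2.1.trans ?_
      rw [pow_succ, ← mul_assoc, ← div_eq_mul_inv _ (2 : ℝ≥0∞)]
      gcongr
  refine ⟨L, N, Q, hLm, fun t => ?_, hN0, strictMono_nat_of_lt_succ fun k => (H k).1, fun k => ⟨?_, ?_⟩⟩
  · rw [abs_of_nonneg (hLle 0 t).1]; exact (hLle 0 t).2.trans (hG0.2 t).2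
  · obtain ⟨h1, h2, h3, h4, h5, h6, h7⟩ := H k
    have hQc : Continuous (Q k) := h7.mem.1
    have m1 : AEStronglyMeasurable (fun t => Q k t * G (k + 1) t - u k t) volume :=
      (hQc.measurable.mul (Complex.measurable_ofReal.comp (hgood _).1)).aestronglyMeasurable.sub (hu k).1
    have m2 : AEStronglyMeasurable (fun t => Q k t * ((L t : ℂ) - G (k + 1) t)) volume :=
      (hQc.measurable.mul ((Complex.measurable_ofReal.comp hLm).sub
        (Complex.measurable_ofReal.comp (hgood _).1))).aestronglyMeasurable
    have e1 : (fun t => Q k t * (L t : ℂ) - u k t)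
        = (fun t => Q k t * G (k + 1) t - u k t) + fun t => Q k t * ((L t : ℂ) - G (k + 1) t) := by
      ext t; simp only [Pi.add_apply]; ring
    rw [e1]
    refine (eLpNorm_add_le m1 m2 (by norm_num)).trans ?_
    have b2 : eLpNorm (fun t => Q k t * ((L t : ℂ) - G (k + 1) t)) 2 volume ≤ ε k := by
      calc _ ≤ ENNReal.ofReal (B k) * eLpNorm (fun t => G (k + 1) t - L t) 2 volume := by
            refine eLpNorm_le_mul_eLpNorm_of_ae_le_mul (ae_of_all _ fun t => ?_) 2
            rw [norm_mul, ← Complex.ofReal_sub, Complex.norm_real, ← norm_neg (G (k + 1) t - L t), neg_sub]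
            gcongr; exact h3 t
        _ ≤ ENNReal.ofReal (B k) * (2 * ε (k + 1)) := by gcongr; exact hdistL _
        _ ≤ ε k := h5
    calc _ ≤ ε k + ε k := add_le_add h6 b2
      _ = 2 * ε k := (two_mul _).symm
      _ ≤ 2 * (ε₀ * 2⁻¹ ^ k) := by gcongr; exact hεk k
      _ = _ := by ring
  · exact (H k).2.2.2.2.2.2.mono (wBall_mono (fun t => hLle (k + 1) t) le_rfl)

/-! ### Modulations become translations under the Fourier transform -/

theorem hasTemperateGrowth_expo (a : ℝ) : (expo a).HasTemperateGrowth := by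
  set c : ℂ := 2 * Real.pi * Complex.I * a
  have hd : ∀ n : ℕ, iteratedDeriv n (expo a) = fun t => c ^ n * expo a t := by
    intro n
    induction n with
    | zero => simp
    | succ n ih =>
      rw [iteratedDeriv_succ, ih]
      ext t
      have h1 : HasDerivAt (fun t : ℝ => c * (t : ℂ)) c t := by
        simpa using (Complex.ofRealCLM.hasDerivAt (x := t)).const_mul c
      have h2 : HasDerivAt (expo a) (expo a t * c) t := h1.cexp
      rw [(h2.const_mul (c ^ n)).deriv, pow_succ]
      ring
  refine ⟨?_, fun n => ⟨0, ‖c‖ ^ n, fun t => ?_⟩⟩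
  · have : ContDiff ℝ ⊤ fun t : ℝ => Complex.exp (c * Complex.ofRealCLM t) :=
      (contDiff_const.mul Complex.ofRealCLM.contDiff).cexp
    exact this.of_le (by simp)
  · rw [norm_iteratedFDeriv_eq_norm_iteratedDeriv, hd, norm_mul, norm_expo, norm_pow, pow_zero]

theorem expo_mul_memLp (a : ℝ) (f : L2R) : MemLp (fun t => expo a t * f t) 2 volume :=
  (Lp.memLp f).of_le ((continuous_expo a).aestronglyMeasurable.mul (Lp.memLp f).1)
    (ae_of_all _ fun t => by rw [norm_mul, norm_expo, one_mul])

/-- Multiplication by the exponential of frequency `a`. -/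
noncomputable def modulate (a : ℝ) (f : L2R) : L2R := (expo_mul_memLp a f).toLp

theorem coeFn_modulate (a : ℝ) (f : L2R) : modulate a f =ᵐ[volume] fun t => expo a t * f t :=
  (expo_mul_memLp a f).coeFn_toLp

theorem isometry_modulate (a : ℝ) : Isometry (modulate a) := by
  intro f g
  rw [Lp.edist_def, Lp.edist_def]
  refine eLpNorm_congr_norm_ae ?_
  filter_upwards [coeFn_modulate a f, coeFn_modulate a g] with t h1 h2
  rw [Pi.sub_apply, Pi.sub_apply, h1, h2, ← mul_sub, norm_mul, norm_expo, one_mul]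

theorem coeFn_translateL2 (a : ℝ) (f : L2R) : translateL2 a f =ᵐ[volume] fun t => f (t - a) :=
  Lp.coeFn_compMeasurePreserving f (measurePreserving_sub_right volume a)

theorem continuous_translateL2 (a : ℝ) : Continuous (translateL2 a) :=
  (Lp.isometry_compMeasurePreserving (measurePreserving_sub_right volume a)).continuous

/-- Both sides are continuous in `f`, so it is enough to compare the integrals for Schwartz
functions, which are dense. -/
theorem fourier_modulate (a : ℝ) (f : L2R) : (𝓕 (modulate a f) : L2R) = translateL2 a (𝓕 f : L2R) := by
  have hF : Continuous fun f : L2R => (𝓕 f : L2R) := (Lp.fourierTransformₗᵢ ℝ ℂ).continuous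
  refine DenseRange.induction_on (p := fun f : L2R => (𝓕 (modulate a f) : L2R) = translateL2 a (𝓕 f : L2R))
    (SchwartzMap.denseRange_toLpCLM (F := ℂ) (p := 2) (μ := (volume : Measure ℝ)) ENNReal.ofNat_ne_top) f
    (isClosed_eq (hF.comp (isometry_modulate a).continuous) ((continuous_translateL2 a).comp hF)) fun φ => ?_
  change (𝓕 (modulate a (φ.toLp 2)) : L2R) = translateL2 a (𝓕 (φ.toLp 2) : L2R)
  have h1 : modulate a (φ.toLp 2) = (SchwartzMap.smulLeftCLM ℂ (expo a) φ).toLp 2 := by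
    refine Lp.ext ?_
    filter_upwards [coeFn_modulate a (φ.toLp 2), φ.coeFn_toLp 2 volume,
      (SchwartzMap.smulLeftCLM ℂ (expo a) φ).coeFn_toLp 2 volume] with t h1 h2 h3
    rw [h1, h2, h3, SchwartzMap.smulLeftCLM_apply_apply (hasTemperateGrowth_expo a), smul_eq_mul]
  rw [h1, SchwartzMap.toLp_fourier_eq, SchwartzMap.toLp_fourier_eq]
  refine Lp.ext ?_
  have h4 := (measurePreserving_sub_right volume a).quasiMeasurePreserving.ae_eq_comp 
    ((𝓕 φ).coeFn_toLp 2 volume)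
  filter_upwards [coeFn_translateL2 a ((𝓕 φ).toLp 2), h4,
    (𝓕 (SchwartzMap.smulLeftCLM ℂ (expo a) φ)).coeFn_toLp 2 volume] with t h1 h2 h3
  simp only [Function.comp_apply] at h2
  rw [h1, h2, h3, SchwartzMap.fourier_coe, SchwartzMap.fourier_coe, Real.fourier_eq', Real.fourier_eq']
  refine integral_congr_ae (ae_of_all _ fun x => ?_)
  simp only [SchwartzMap.smulLeftCLM_apply_apply (hasTemperateGrowth_expo a), smul_eq_mul]
  rw [← mul_assoc, expo, ← Complex.exp_add]
  congr 2
  simp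
  ring

/-! ### Parseval sequences and coefficient functionals -/

theorem Orthonormal.countable_index {H : Type*} [NormedAddCommGroup H]
    [InnerProductSpace ℂ H] [TopologicalSpace.SeparableSpace H] {ι : Type*} {v : ι → H}
    (hv : Orthonormal ℂ v) : Countable ι := by
  have h : (Set.univ : Set ι).PairwiseDisjoint fun i => Metric.ball (v i) (1 / 2) := by
    intro i _ j _ hij
    refine Metric.ball_disjoint_ball ?_
    have h1 : ‖v i - v j‖ ^ 2 = 2 := by
      rw [@norm_sub_sq ℂ, hv.2 hij, hv.1, hv.1]; simp; norm_num
    rw [dist_eq_norm]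
    nlinarith [norm_nonneg (v i - v j)]
  exact Set.countable_univ_iff.1 (h.countable_of_isOpen (fun _ _ => Metric.isOpen_ball)
    fun i _ => Metric.nonempty_ball.2 (by norm_num))

section Hilbert

variable {H : Type*} [NormedAddCommGroup H] [InnerProductSpace ℂ H] [CompleteSpace H]

variable (H) in
theorem exists_parseval_sequence [TopologicalSpace.SeparableSpace H] : ∃ u : ℕ → H,
    (∀ k, ‖u k‖ ≤ 1) ∧ ∀ f, HasSum (fun k => ⟪u k, f⟫_ℂ • u k) f := by
  obtain ⟨w, b, -⟩ := exists_hilbertBasis ℂ H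
  have : Countable w := b.orthonormal.countable_index
  have := Encodable.ofCountable w
  refine ⟨fun n => (Encodable.decode₂ w n).elim 0 b, fun k => ?_, fun f => ?_⟩
  · cases h : Encodable.decode₂ w k with
    | none => simp [h]
    | some i => simpa [h] using (b.orthonormal.1 i).le
  · rw [← (Encodable.encode_injective (α := w)).hasSum_iff]
    · convert b.hasSum_repr f using 2 with i
      simp [HilbertBasis.repr_apply_apply]
    · intro k hk
      cases h : Encodable.decode₂ w k with
      | none => simp [h]
      | some i => exact absurd ⟨i, Encodable.mem_decode₂.1 h⟩ hk

theorem exists_block_index {N : ℕ → ℕ} (hN0 : N 0 = 0) (hN : StrictMono N) :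
    ∃ κ : ℕ → ℕ, (∀ n, N (κ n) ≤ n ∧ n < N (κ n + 1)) ∧ (∀ k n, N k ≤ n → n < N (k + 1) → κ n = k) ∧
      Tendsto κ atTop atTop := by
  have h : ∀ n, ∃ k, N k ≤ n ∧ n < N (k + 1) := by
    intro n
    induction n with
    | zero => exact ⟨0, hN0.le, hN0.symm.trans_lt (hN (Nat.lt_succ_self 0))⟩
    | succ n ih =>
      obtain ⟨k, h1, h2⟩ := ih
      rcases Nat.lt_or_ge (n + 1) (N (k + 1)) with h | h
      · exact ⟨k, by omega, h⟩
      · exact ⟨k + 1, h, lt_of_le_of_lt h2 (hN (Nat.lt_succ_self _))⟩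
  choose κ hκ using h
  refine ⟨κ, hκ, fun k n h1 h2 => ?_, tendsto_atTop.2 fun K => ?_⟩
  · have a := hN.lt_iff_lt.1 (lt_of_le_of_lt h1 (hκ n).2)
    have b := hN.lt_iff_lt.1 (lt_of_le_of_lt (hκ n).1 h2)
    omega
  · filter_upwards [eventually_ge_atTop (N K)] with n hn
    have := hN.lt_iff_lt.1 (lt_of_le_of_lt hn (hκ n).2)
    omega

/-- The operator `f ↦ ∑ ⟨u k, f⟩ P k` differs from the identity by `∑ R k`, of norm at most `1/2`,
so it has an inverse `V` and `f = ∑ ⟨u k, V f⟩ P k`. Spreading each coefficient over its block costs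
at most `|⟨u k, V f⟩| D`, which tends to `0`. -/
theorem exists_dual_of_blocks {u : ℕ → H} (hu1 : ∀ k, ‖u k‖ ≤ 1) (hu : ∀ f, HasSum (fun k => ⟪u k, f⟫_ℂ • u k) f)
    {N : ℕ → ℕ} (hN0 : N 0 = 0) (hN : StrictMono N) {x : ℕ → H} {c : ℕ → ℂ} {D : ℝ}
    (hP : ∀ k, ‖∑ n ∈ Finset.Ico (N k) (N (k + 1)), c n • x n - u k‖ ≤ 1 / 4 * (1 / 2) ^ k)
    (hD : ∀ k m, N k ≤ m → m ≤ N (k + 1) → ‖∑ n ∈ Finset.Ico (N k) m, c n • x n‖ ≤ D) :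
    ∃ gstar : ℕ → H, ∀ f, Tendsto (fun n => ∑ i ∈ Finset.range n, ⟪gstar i, f⟫_ℂ • x i) atTop (𝓝 f) := by
  obtain ⟨κ, hκ, hκu, hκt⟩ := exists_block_index hN0 hN
  set P : ℕ → H := fun k => ∑ n ∈ Finset.Ico (N k) (N (k + 1)), c n • x n with hPdef
  set R : ℕ → H →L[ℂ] H := fun k => (innerSL ℂ (u k)).smulRight (P k - u k) with hR
  have hRn : ∀ k, ‖R k‖ ≤ 1 / 4 * (1 / 2) ^ k := fun k => by
    rw [hR, ContinuousLinearMap.norm_smulRight_apply, innerSL_apply_norm]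
    exact (mul_le_mul (hu1 k) (hP k) (norm_nonneg _) zero_le_one).trans_eq (one_mul _)
  have hgeo : HasSum (fun k : ℕ => (1 / 4 : ℝ) * (1 / 2) ^ k) (1 / 4 * 2) := hasSum_geometric_two.mul_left _
  have hRs : Summable R := Summable.of_norm_bounded hgeo.summable hRn
  have hS : ‖-∑' k, R k‖ < 1 := by
    rw [norm_neg]
    exact lt_of_le_of_lt (tsum_of_norm_bounded hgeo hRn) (by norm_num)
  set V : H →L[ℂ] H := (((Units.oneSub _ hS)⁻¹ : (H →L[ℂ] H)ˣ) : H →L[ℂ] H)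
  have hV : ∀ f, V f + (∑' k, R k) (V f) = f := fun f => by
    have : (1 - -∑' k, R k) * V = 1 := by
      rw [← Units.val_oneSub _ hS]; exact Units.mul_inv _
    simpa using congrArg (fun A : H →L[ℂ] H => A f) this
  have hsum : ∀ f, HasSum (fun k => ⟪u k, V f⟫_ℂ • P k) f := fun f => by
    have h1 : HasSum (fun k => R k (V f)) ((∑' k, R k) (V f)) :=
      hRs.hasSum.mapL (ContinuousLinearMap.apply ℂ H (V f))
    have h2 := (hu (V f)).add h1
    rw [hV] at h2
    convert h2 using 2 with k
    simp [hR, smul_sub]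
  have hcoef : ∀ v, Tendsto (fun k => ‖⟪u k, v⟫_ℂ‖) atTop (𝓝 0) := fun v => by
    have h1 := ((hu v).mapL (innerSL ℂ v)).summable.tendsto_atTop_zero.norm
    have h2 : ∀ k, ‖innerSL ℂ v (⟪u k, v⟫_ℂ • u k)‖ = ‖⟪u k, v⟫_ℂ‖ ^ 2 := fun k => by
      rw [innerSL_apply_apply, inner_smul_right, norm_mul, norm_inner_symm v, sq]
    simp only [h2, norm_zero] at h1
    have h3 := h1.sqrt
    simpa using h3
  -- The inner product is conjugate-linear in its first slot, hence the conjugate of `c n`.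
  refine ⟨fun n => (starRingEnd ℂ) (c n) • ContinuousLinearMap.adjoint V (u (κ n)), fun f => ?_⟩
  have hterm : ∀ i, ⟪(starRingEnd ℂ) (c i) • ContinuousLinearMap.adjoint V (u (κ i)), f⟫_ℂ • x i
      = ⟪u (κ i), V f⟫_ℂ • (c i • x i) := fun i => by
    rw [inner_smul_left, Complex.conj_conj, ContinuousLinearMap.adjoint_inner_left, smul_smul, mul_comm]
  simp only [hterm]
  have hblock : ∀ k m, N k ≤ m → m ≤ N (k + 1) → ∑ i ∈ Finset.Ico (N k) m, ⟪u (κ i), V f⟫_ℂ • (c i • x i)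
      = ⟪u k, V f⟫_ℂ • ∑ i ∈ Finset.Ico (N k) m, c i • x i := fun k m h1 h2 => by
    rw [Finset.smul_sum]
    refine Finset.sum_congr rfl fun i hi => ?_
    rw [Finset.mem_Ico] at hi
    rw [hκu k i hi.1 (lt_of_lt_of_le hi.2 h2)]
  have hfull : ∀ k, ∑ i ∈ Finset.range (N k), ⟪u (κ i), V f⟫_ℂ • (c i • x i)
      = ∑ j ∈ Finset.range k, ⟪u j, V f⟫_ℂ • P j := by
    intro k
    induction k with
    | zero => simp [hN0]
    | succ k ih =>
      rw [Finset.sum_range_succ, ← ih, ← hblock k _ (hN.monotone (Nat.le_succ k)) le_rfl,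
        Finset.sum_range_add_sum_Ico _ (hN.monotone (Nat.le_succ k))]
  have hsplit : ∀ n, ∑ i ∈ Finset.range n, ⟪u (κ i), V f⟫_ℂ • (c i • x i)
      = ∑ j ∈ Finset.range (κ n), ⟪u j, V f⟫_ℂ • P j
        + ⟪u (κ n), V f⟫_ℂ • ∑ i ∈ Finset.Ico (N (κ n)) n, c i • x i := fun n => by
    rw [← hfull, ← hblock _ _ (hκ n).1 (hκ n).2.le, Finset.sum_range_add_sum_Ico _ (hκ n).1]
  simp only [hsplit]
  have h1 := (hsum f).tendsto_sum_nat.comp hκt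
  have h2 : Tendsto (fun n => ⟪u (κ n), V f⟫_ℂ • ∑ i ∈ Finset.Ico (N (κ n)) n, c i • x i) atTop (𝓝 0) := by
    have h3 := ((hcoef (V f)).comp hκt).mul_const D
    rw [zero_mul] at h3
    refine squeeze_zero_norm (fun n => ?_) h3
    rw [norm_smul]
    exact mul_le_mul_of_nonneg_left (hD _ _ (hκ n).1 (hκ n).2.le) (norm_nonneg _)
  simpa using h1.add h2

end Hilbert

/-! ### Assembly -/

theorem theorem1p1 :
    ∃ (lam : ℕ → ℝ) (g : L2R) (gstar : ℕ → L2R),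
      StrictMono lam ∧
      UniformlyDiscrete lam ∧
      IsSmallPerturbationOfPositiveIntegers lam ∧
      (∀ f : L2R, Tendsto
        (fun N => ∑ n ∈ Finset.range N, (inner ℂ (gstar n) f : ℂ) • translateL2 (lam n) g)
        atTop (𝓝 f)) ∧
      IsSchauderFrame ℂ (fun n => translateL2 (lam n) g) (fun n => innerSL ℂ (gstar n)) := by
  have : Fact ((2 : ℝ≥0∞) ≠ ⊤) := ⟨ENNReal.ofNat_ne_top⟩
  obtain ⟨u, hu1, hu⟩ := exists_parseval_sequence L2R
  -- Offsets below `1 / (k + 4)` tend to `0` along the blocks and never exceed `1/4`, which gives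
  -- separation and monotonicity.
  have hη : ∀ k : ℕ, (0 : ℝ) < 1 / (k + 4) := fun k => by positivity
  -- The value `1/8` makes the block errors `2 ε₀ 2⁻ᵏ` equal to `2⁻ᵏ/4`, as `exists_dual_of_blocks`
  -- requires.
  obtain ⟨G, N, Q, hGm, hG, hN0, hN, hQ⟩ := exists_weight_blocks (fun k => Lp.memLp (u k)) hη
    (ε₀ := ENNReal.ofReal (1 / 8)) (by simp)
  obtain ⟨κ, hκ, hκu, hκt⟩ := exists_block_index hN0 hN
  choose hQ1 _ Y hY1 hY2 hY3 using hQ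
  -- Even an atom with `c n = 0` carries a perturbed frequency, so every positive integer `n + 1` is
  -- used exactly once.
  choose c a ha0 ha1 hYc using fun n => hY1 (κ n) n
  have hGL : MemLp (fun t => (G t : ℂ)) 2 volume := by
    simpa using memLp_mul_weight hGm hG (f := fun _ => 1) continuous_const (B := 1) (by simp)
  set lam : ℕ → ℝ := fun n => n + 1 + a n with hlam
  set x : ℕ → L2R := fun n => modulate (lam n) hGL.toLp with hx
  have ha4 : ∀ n, a n < 1 / 4 := fun n => (ha1 n).trans_le (by
    apply one_div_le_one_div_of_le (by norm_num); linarith [(Nat.cast_nonneg (κ n) : (0 : ℝ) ≤ κ n)])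
  have hcoe : ∀ s : Finset ℕ, (∑ n ∈ s, c n • x n : L2R) =ᵐ[volume] fun t => (∑ n ∈ s, Y (κ n) n) t * G t := by
    intro s
    induction s using Finset.induction_on with
    | empty =>
      filter_upwards [Lp.coeFn_zero ℂ 2 (volume : Measure ℝ)] with t _
      simp
    | insert i s hi ih =>
      rw [Finset.sum_insert hi, Finset.sum_insert hi]
      filter_upwards [Lp.coeFn_add (c i • x i) (∑ n ∈ s, c n • x n), ih, Lp.coeFn_smul (c i) (x i),
        coeFn_modulate (lam i) hGL.toLp, hGL.coeFn_toLp] with t h1 h2 h3 h4 h5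
      rw [h1, Pi.add_apply, h2, h3, Pi.smul_apply, h4, h5, Pi.add_apply, hYc, smul_eq_mul]
      ring
  have hblock : ∀ k m, m ≤ N (k + 1) → ∑ n ∈ Finset.Ico (N k) m, Y (κ n) n = ∑ n ∈ Finset.Ico (N k) m, Y k n := by
    intro k m hm
    refine Finset.sum_congr rfl fun n hn => ?_
    rw [Finset.mem_Ico] at hn
    rw [hκu k n hn.1 (lt_of_lt_of_le hn.2 hm)]
  -- `D = 2` comes from the bound `‖u k‖ + 1` on partial sums.
  obtain ⟨gstar, hgstar⟩ := exists_dual_of_blocks hu1 hu hN0 hN (x := x) (c := c) (D := 2)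
    (fun k => by
      have h1 : ‖∑ n ∈ Finset.Ico (N k) (N (k + 1)), c n • x n - u k‖ₑ ≤ ENNReal.ofReal (1 / 4 * (1 / 2) ^ k) := by
        rw [Lp.enorm_def]
        refine le_trans (le_of_eq (eLpNorm_congr_ae ?_)) ((hQ1 k).trans (le_of_eq ?_))
        · filter_upwards [Lp.coeFn_sub (∑ n ∈ Finset.Ico (N k) (N (k + 1)), c n • x n) (u k),
            hcoe (Finset.Ico (N k) (N (k + 1)))] with t h1 h2
          rw [h1, Pi.sub_apply, h2, hblock k _ le_rfl, hY3]
        · rw [ENNReal.ofReal_mul (by norm_num), ENNReal.ofReal_pow (by norm_num),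
            show (2 : ℝ≥0∞) * ENNReal.ofReal (1 / 8) = ENNReal.ofReal (1 / 4) by
              rw [show (2 : ℝ≥0∞) = ENNReal.ofReal 2 by simp, ← ENNReal.ofReal_mul (by norm_num)]; norm_num]
          simp [ENNReal.ofReal_inv_of_pos]
      rw [← ofReal_norm] at h1
      exact (ENNReal.ofReal_le_ofReal_iff (by positivity)).1 h1)
    (fun k m hkm hm => by
      have h1 : ‖∑ n ∈ Finset.Ico (N k) m, c n • x n‖ₑ ≤ ENNReal.ofReal 2 := by
        rw [Lp.enorm_def]
        have h2 := (hY2 k m hkm hm).2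
        refine le_trans (le_of_eq (eLpNorm_congr_ae ?_)) (h2.trans ?_)
        · rw [← hblock k m hm]; exact hcoe _
        · rw [← Lp.enorm_def, ← ofReal_norm, ← ENNReal.ofReal_one,
            ← ENNReal.ofReal_add (norm_nonneg _) zero_le_one]
          exact ENNReal.ofReal_le_ofReal (by linarith [hu1 k])
      rw [← ofReal_norm] at h1
      exact (ENNReal.ofReal_le_ofReal_iff (by norm_num)).1 h1)
  have hconv : ∀ f : L2R, Tendsto (fun N => ∑ n ∈ Finset.range N,
      (inner ℂ (𝓕 (gstar n) : L2R) f : ℂ) • translateL2 (lam n) (𝓕 (hGL.toLp : L2R) : L2R)) atTop (𝓝 f) := by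
    intro f
    set F := Lp.fourierTransformₗᵢ ℝ ℂ
    have h1 := (F.continuous.tendsto _).comp (hgstar (F.symm f))
    rw [F.apply_symm_apply] at h1
    refine h1.congr fun n => ?_
    rw [Function.comp_apply, map_sum]
    refine Finset.sum_congr rfl fun i _ => ?_
    rw [map_smul, ← fourier_modulate]
    congr 1
    rw [← F.inner_map_map, F.apply_symm_apply]
    rfl
  refine ⟨lam, 𝓕 (hGL.toLp : L2R), fun n => 𝓕 (gstar n), strictMono_nat_of_lt_succ fun n => ?_, ⟨1 / 2, by norm_num,
    fun n m hnm => ?_⟩, ⟨fun n => n + 1, fun i j h => by simpa using h, fun n => Nat.succ_pos n, fun n => ?_, ?_⟩,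
    hconv, hconv⟩
  · simp only [hlam]; push_cast
    linarith [ha0 (n + 1), ha4 n]
  · have h1 : (1 : ℝ) ≤ |(m : ℝ) - n| := by
      have : (1 : ℤ) ≤ |(m : ℤ) - n| := Int.one_le_abs (by omega)
      exact_mod_cast this
    have h2 : |a n - a m| ≤ 1 / 4 := abs_le.2 ⟨by linarith [ha0 n, ha4 m], by linarith [ha0 m, ha4 n]⟩
    have h3 : |(m : ℝ) - n| ≤ |lam m - lam n| + |a n - a m| := by
      refine le_trans (le_of_eq ?_) (abs_add_le _ _)
      congr 1; simp only [hlam]; ring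
    linarith
  · simp only [hlam]; push_cast
    linarith [ha0 n]
  · have h1 : Tendsto (fun n => (1 : ℝ) / ((κ n : ℝ) + 4)) atTop (𝓝 0) := by
      have h2 : Tendsto (fun k : ℕ => (k : ℝ) + 4) atTop atTop :=
        tendsto_natCast_atTop_atTop.atTop_add tendsto_const_nhds
      simpa only [one_div, Function.comp_def] using (tendsto_inv_atTop_zero.comp h2).comp hκt
    refine squeeze_zero (fun n => ?_) (fun n => ?_) h1
    · simp only [hlam]; push_cast; linarith [ha0 n]
    · simp only [hlam]; push_cast; linarith [ha1 n]
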